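/- **Theorem (Equivalence of Corrections).** Let $U:\mathbb R^d\to\mathbb R^d$ be $C^2$ and globally Lipschitz, with symmetric Jacobian $J_U=J_U^T$. For a step size $\eta>0$ put $\Phi^U_\eta(\theta)=\theta-\eta U(\theta)$. Throughout, $O(\eta^m)$ refers to $\eta\to0^+$ and is uniform for $\theta$ in compact sets. Consider families of functions $\phi=(\phi_\eta)_{\eta>0}$ on $\mathbb R^d$, and call $\phi$ * a *discretization error potential* (DE) if each $\phi_\eta$ is $C^2$, $\nabla\phi_\eta$ and its first derivative are $O(\eta)$, and for every fixed $N$ and all sufficiently small $\eta$ (locally uniformly in $\theta$) the solution of $\dot\gamma=-\eta\,(U+\nabla\phi_\eta)(\gamma)$, $\gamma(0)=\theta$, exists on $[0,N]$ and satisfies $(\Phi^U_\eta)^{t}(\theta)=\gamma(t)+O(\eta^3)$ for $t=0,1,\dots,N$; * a *time reversal asymmetry potential* (TA) if each $\phi_\eta$ is differentiable and $2\eta\nabla\phi_\eta(\theta)=\theta-\tilde\theta+O(\eta^3)$, where $\tilde\theta=\theta-\eta U(\theta)+\eta U(\Phi^U_\eta(\theta))$ is the state recovered by a forward and then a backward step;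 * a *time renormalization potential* (TR) of a refinement $(U_k)_{k\ge0}$ of $U$ if each $\phi_\eta$ is differentiable and, locally uniformly for small $\eta$, the limit $U_\infty=\lim_{k\to\infty}U_k$ exists and $U_\infty=U+\nabla\phi_\eta+O(\eta^2)$. Here a *refinement* is a family of differentiable fields $U_k=U_{k}^{(\eta)}$ with $U_0=U$, such that $U_k-U$ and its first derivative are $O(\eta)$ uniformly in $k$ and, with $\eta_k=\eta/2^k$, $\Phi^{U_{k+1}}_{\eta_{k+1}}\circ\Phi^{U_{k+1}}_{\eta_{k+1}}=\Phi^{U_k}_{\eta_k}+O(\eta_k^3)$ uniformly in $k$; * a *stochastic entropy potential* (ST) if for all $\eta>0$ and $\mu\in\mathbb R^d$ the iterated limit $\lim_{\tau\to0}\lim_{\sigma\to0}\sigma^2\,\mathbb E[\Delta S_{\rm tot}]$ exists and equals $8\eta\,\phi_\eta(\mu)+O(\eta^3)$. Here $\theta_k\sim\mathcal N(\mu,\tau I)$, $\theta_{k+1}=\theta_k-\eta U(\theta_k)+\sigma\varepsilon$ with an independent $\varepsilon\sim\mathcal N(0,I)$, and $\Delta S_{\rm tot}=\Delta S_{\rm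 bath}+\Delta S_{\rm sys}$, where $\Delta S_{\rm bath}=\ln\frac{p(\theta_{k+1}|\theta_k)}{p(\theta_k|\theta_{k+1})}$ with $p(\cdot|\cdot)$ the transition density, and $\Delta S_{\rm sys}$ is the Shannon (differential) entropy of the law of $\theta_{k+1}$ minus that of $\theta_k$; all these expectations are required to converge. Then $U$ has a refinement, even one all of whose fields have symmetric Jacobian. For each $X\in\{\mathrm{DE},\mathrm{TA},\mathrm{TR},\mathrm{ST}\}$ (for TR: for every refinement of $U$) the function $\frac{\eta}{4}\|U(\theta)\|^2$ is a potential of type $X$, and every potential $\phi_X$ of type $X$ satisfies $$\phi_{X,\eta}(\theta)=\frac{\eta}{4}\|U(\theta)\|^2+O(\eta^2),$$ where for $X\in\{\mathrm{DE},\mathrm{TA},\mathrm{TR}\}$, whose definition involves only $\nabla\phi_X$, this holds after adding to $\phi_{X,\eta}$ a suitable constant depending only on $\eta$. Moreover, integrating the exact time-asymmetry force along the straight segment from any fixed reference point $\theta_{\rm ref}$ gives $$\int_0^1\frac{\vartheta_s-\tilde\vartheta_s}{2\eta}\cdot(\theta-\theta_{\rm ref})\,ds=\frac\eta4\|U(\theta)\|^2-\frac\eta4\|U(\theta_{\rm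 ref})\|^2+O(\eta^2),\qquad \vartheta_s=\theta_{\rm ref}+s(\theta-\theta_{\rm ref}).$$ -/

import Mathlib

open Filter Topology MeasureTheory

noncomputable section

namespace Irrev

/-- Parameter space `ℝ^d` with the Euclidean norm. -/
abbrev Param (d : ℕ) : Type := EuclideanSpace ℝ (Fin d)

variable {d : ℕ}

/-- The Jacobian of `U` is symmetric at every point. -/
def SymmetricJacobian (U : Param d → Param d) : Prop :=
  ∀ θ, (fderiv ℝ U θ : Param d →ₗ[ℝ] Param d).IsSymmetric

/-- `r η θ = O(η^m)` as `η → 0⁺`, locally uniformly in `θ`. -/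
def LocO {F : Type*} [Norm F] (m : ℕ) (r : ℝ → Param d → F) : Prop :=
  ∀ K : Set (Param d), IsCompact K → ∃ C η₀ : ℝ, 0 < η₀ ∧
    ∀ η : ℝ, 0 < η → η < η₀ → ∀ θ ∈ K, ‖r η θ‖ ≤ C * η ^ m

/-- The leading-order potential `(η/4) ‖U(θ)‖²`. -/
def leading (U : Param d → Param d) (η : ℝ) (θ : Param d) : ℝ :=
  η / 4 * ‖U θ‖ ^ 2

/-- `φ_η(θ) = (η/4) ‖U(θ)‖² + O(η²)`. -/
def EqLeading (U : Param d → Param d) (φ : ℝ → Param d → ℝ) : Prop :=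
  LocO 2 fun η θ => φ η θ - leading U η θ

/-- `φ_η(θ) = (η/4) ‖U(θ)‖² + O(η²)` once the additive constant of `φ_η`, which a condition on
`∇φ_η` leaves free, is chosen suitably. -/
def EqLeadingUpToConst (U : Param d → Param d) (φ : ℝ → Param d → ℝ) : Prop :=
  ∃ c : ℝ → ℝ, EqLeading U fun η θ => φ η θ + c η

/-- The discrete update `θ ↦ θ - η U(θ)`. -/
def update (U : Param d → Param d) (η : ℝ) (θ : Param d) : Param d :=
  θ - η • U θ

/-! ### Discretization error -/

/-- `γ` solves `γ' = -η V(γ)`, `γ(0) = θ` on `[0, T]`. -/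
def IsFlowLine (V : Param d → Param d) (η T : ℝ) (θ : Param d) (γ : ℝ → Param d) : Prop :=
  γ 0 = θ ∧ ∀ s ∈ Set.Icc (0 : ℝ) T, HasDerivWithinAt γ (-(η • V (γ s))) (Set.Icc 0 T) s

/-- `φ` is a discretization error potential: the correction `∇φ_η` is `O(η)` (with its first
derivative), and the flow of `U + ∇φ_η` follows the discrete iterates to the order `O(η³)`, one
order better than the flow of `U`, over every fixed number `N` of iterations. -/
structure IsDEPotential (U : Param d → Param d) (φ : ℝ → Param d → ℝ) : Prop where
  smooth : ∀ η : ℝ, 0 < η → ContDiff ℝ 2 (φ η)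
  force_small : LocO 1 fun η θ => gradient (φ η) θ
  deriv_small : LocO 1 fun η θ => fderiv ℝ (gradient (φ η)) θ
  matching : ∀ N : ℕ, ∀ K : Set (Param d), IsCompact K → ∃ C η₀ : ℝ, 0 < η₀ ∧
    ∀ η : ℝ, 0 < η → η < η₀ → ∀ θ ∈ K, ∃ γ : ℝ → Param d,
      IsFlowLine (fun x => U x + gradient (φ η) x) η N θ γ ∧
      ∀ t : ℕ, t ≤ N → ‖(update U η)^[t] θ - γ t‖ ≤ C * η ^ 3

/-! ### Time reversal asymmetry -/

/-- The state recovered by a forward step followed by a backward step. -/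
def recovered (U : Param d → Param d) (η : ℝ) (θ : Param d) : Param d :=
  θ - η • U θ + η • U (update U η θ)

/-- `φ` is a time reversal asymmetry potential: `2η ∇φ_η(θ) = θ - θ̃ + O(η³)`. The residual
`θ - θ̃` is in general a gradient only to leading order, hence the remainder. -/
structure IsTAPotential (U : Param d → Param d) (φ : ℝ → Param d → ℝ) : Prop where
  smooth : ∀ η : ℝ, 0 < η → Differentiable ℝ (φ η)
  force : LocO 3 fun η θ => (2 * η) • gradient (φ η) θ - (θ - recovered U η θ)

/-- The time asymmetry potential rebuilt from the exact force `(θ - θ̃)/(2η)` by integration along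
the straight segment from the reference point `θref` to `θ`. -/
def taLinePotential (U : Param d → Param d) (θref : Param d) (η : ℝ) (θ : Param d) : ℝ :=
  ∫ s in (0 : ℝ)..1,
    inner ℝ ((2 * η)⁻¹ • ((θref + s • (θ - θref)) - recovered U η (θref + s • (θ - θref))))
      (θ - θref)

/-! ### Time renormalization -/

/-- `V η k` is the field `U_k` at step size `η_k = η / 2^k` of a refinement of `U = U_0`: two steps
of `U_{k+1}` at `η_{k+1}` reproduce one step of `U_k` at `η_k` with local error `O(η_k³)`, uniformly
over the scales `k`. The corrections `U_k - U` are `O(η)` with their first derivatives. -/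
structure IsRefinement (U : Param d → Param d) (V : ℝ → ℕ → Param d → Param d) : Prop where
  zero : ∀ η : ℝ, 0 < η → V η 0 = U
  smooth : ∀ η : ℝ, 0 < η → ∀ k, Differentiable ℝ (V η k)
  small : ∀ K : Set (Param d), IsCompact K → ∃ C η₀ : ℝ, 0 < η₀ ∧
    ∀ η : ℝ, 0 < η → η < η₀ → ∀ k, ∀ θ ∈ K,
      ‖V η k θ - U θ‖ ≤ C * η ∧ ‖fderiv ℝ (V η k) θ - fderiv ℝ U θ‖ ≤ C * η
  consistent : ∀ K : Set (Param d), IsCompact K → ∃ C η₀ : ℝ, 0 < η₀ ∧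
    ∀ η : ℝ, 0 < η → η < η₀ → ∀ k, ∀ θ ∈ K,
      ‖update (V η (k + 1)) (η / 2 ^ (k + 1)) (update (V η (k + 1)) (η / 2 ^ (k + 1)) θ)
        - update (V η k) (η / 2 ^ k) θ‖ ≤ C * (η / 2 ^ k) ^ 3

/-- `φ` is the time renormalization potential of the refinement `V`: the continuous limit
`U_∞ = lim_k U_k` exists and `U_∞ = U + ∇φ_η + O(η²)`. -/
structure IsTRPotential (U : Param d → Param d) (V : ℝ → ℕ → Param d → Param d)
    (φ : ℝ → Param d → ℝ) : Prop where
  smooth : ∀ η : ℝ, 0 < η → Differentiable ℝ (φ η)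
  limit : ∀ K : Set (Param d), IsCompact K → ∃ C η₀ : ℝ, 0 < η₀ ∧
    ∀ η : ℝ, 0 < η → η < η₀ → ∀ θ ∈ K, ∃ W : Param d,
      Tendsto (fun k => V η k θ) atTop (𝓝 W) ∧
      ‖W - (U θ + gradient (φ η) θ)‖ ≤ C * η ^ 2

/-! ### Stochastic entropy -/

/-- Density of `N(m, v I)` on `ℝ^d`. -/
def gaussDensity (m : Param d) (v : ℝ) (x : Param d) : ℝ :=
  (2 * Real.pi * v) ^ (-(d : ℝ) / 2) * Real.exp (-‖x - m‖ ^ 2 / (2 * v))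

/-- The law `N(m, v I)` on `ℝ^d`. -/
def gauss (m : Param d) (v : ℝ) : Measure (Param d) :=
  volume.withDensity fun x => ENNReal.ofReal (gaussDensity m v x)

/-- Transition density `p(θ' | θ)` of `θ' = θ - η U(θ) + σ ε`, `ε ∼ N(0, I)`. -/
def transition (U : Param d → Param d) (η σ : ℝ) (θ' θ : Param d) : ℝ :=
  gaussDensity (update U η θ) (σ ^ 2) θ'

/-- The noisy update as a function of the pair `(θ, ε)`. -/
def noisyUpdate (U : Param d → Param d) (η σ : ℝ) (z : Param d × Param d) : Param d :=
  update U η z.1 + σ • z.2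

/-- Joint law of `(θ_k, ε_k)`: independent, `θ_k ∼ N(μ, τ I)` and `ε_k ∼ N(0, I)`. -/
def jointLaw (μ : Param d) (τ : ℝ) : Measure (Param d × Param d) :=
  (gauss μ τ).prod (gauss 0 1)

/-- Law of `θ_{k+1}`. -/
def nextLaw (U : Param d → Param d) (η σ : ℝ) (μ : Param d) (τ : ℝ) : Measure (Param d) :=
  (jointLaw μ τ).map (noisyUpdate U η σ)

/-- Entropy change of the bath, `log (p(θ_{k+1} | θ_k) / p(θ_k | θ_{k+1}))`. -/
def bathEntropy (U : Param d → Param d) (η σ : ℝ) (z : Param d × Param d) : ℝ :=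
  Real.log (transition U η σ (noisyUpdate U η σ z) z.1 /
    transition U η σ z.1 (noisyUpdate U η σ z))

/-- The log-density of a law with respect to Lebesgue measure. -/
def logDensity (ν : Measure (Param d)) (x : Param d) : ℝ :=
  Real.log (ν.rnDeriv volume x).toReal

/-- Shannon (differential) entropy. -/
def shannon (ν : Measure (Param d)) : ℝ :=
  -∫ x, logDensity ν x ∂ν

/-- `𝔼[ΔS_tot] = 𝔼[ΔS_bath] + ΔS_sys`, with `ΔS_sys` the change of the Shannon entropy. -/
def meanTotalEntropy (U : Param d → Param d) (η σ : ℝ) (μ : Param d) (τ : ℝ) : ℝ :=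
  (∫ z, bathEntropy U η σ z ∂(jointLaw μ τ)) +
    (shannon (nextLaw U η σ μ τ) - shannon (gauss μ τ))

/-- The expectations that enter `meanTotalEntropy` are those of honest (absolutely continuous)
probability laws and converge. -/
structure EntropyWellDefined (U : Param d → Param d) (η σ : ℝ) (μ : Param d) (τ : ℝ) : Prop where
  init_prob : IsProbabilityMeasure (gauss μ τ)
  next_prob : IsProbabilityMeasure (nextLaw U η σ μ τ)
  next_ac : nextLaw U η σ μ τ ≪ volume
  bath : Integrable (bathEntropy U η σ) (jointLaw μ τ)
  sys_init : Integrable (logDensity (gauss μ τ)) (gauss μ τ)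
  sys_next : Integrable (logDensity (nextLaw U η σ μ τ)) (nextLaw U η σ μ τ)

/-- `lim_{τ → 0} lim_{σ → 0} σ² 𝔼[ΔS_tot] = L`. -/
def HasScaledEntropyProduction (U : Param d → Param d) (η : ℝ) (μ : Param d) (L : ℝ) : Prop :=
  (∀ τ σ : ℝ, 0 < τ → 0 < σ → EntropyWellDefined U η σ μ τ) ∧
  ∃ l : ℝ → ℝ,
    (∀ τ : ℝ, 0 < τ →
      Tendsto (fun σ : ℝ => σ ^ 2 * meanTotalEntropy U η σ μ τ) (𝓝[>] 0) (𝓝 (l τ))) ∧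
    Tendsto l (𝓝[>] 0) (𝓝 L)

/-- `φ` is a stochastic entropy potential: the scaled entropy production
`lim_{τ → 0} lim_{σ → 0} σ² 𝔼[ΔS_tot]` exists and equals `8η φ_η(μ) + O(η³)`. -/
def IsSTPotential (U : Param d → Param d) (φ : ℝ → Param d → ℝ) : Prop :=
  ∃ L : ℝ → Param d → ℝ,
    (∀ η : ℝ, 0 < η → ∀ μ, HasScaledEntropyProduction U η μ (L η μ)) ∧
    LocO 3 fun η μ => L η μ - 8 * η * φ η μ

end Irrev

end

/-!
Since `J_U` is symmetric, `J_U U` is the gradient of `‖U‖² / 2`, so a force `(η / 2) J_U U + O(η²)`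
has the potential `(η / 4) ‖U‖² + O(η²)`, up to an additive constant. Second-order Taylor
expansion produces this force in three ways. A forward and a backward step miss each other by
`η² J_U U + O(η³)`. Two steps of a flow and of its Euler scheme agree up to `O(η³)` only when the
field of the flow is corrected by `(η / 2) J_U U`. Halving the step of size `η / 2 ^ k` in a
refinement adds `(η / 2 ^ (k + 2)) J_U U`, and these corrections sum to `(η / 2) J_U U`.

A refinement is obtained by transporting `U` along itself: the solution `W_c` of
`W(θ) = U(θ + c W(θ))` satisfies the Burgers equation `∂_c W = J_W W`, its Jacobian is again
symmetric, and the midpoint rule compares the fields of transport times `c` and `c + η_k / 4`.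

For the stochastic potential, the Gaussian transition densities give
`σ² ΔS_bath → ‖η (U(θ) + U(Φ_η(θ)))‖² / 2 = 2 η² ‖U(θ)‖² + O(η³)`, while the Shannon entropy of
`θ_{k+1}` is at least a multiple of `log σ` up to a constant, because its density is bounded by that
of the noise, and is bounded above by its second moment; so `σ² ΔS_sys → 0`.
-/

noncomputable section

namespace Irrev

lemma exists_norm_le_of_continuous {E F : Type*} [NormedAddCommGroup E] [NormedAddCommGroup F]
    [ProperSpace E] {f : E → F} (hf : Continuous f) (R : ℝ) : ∃ C, ∀ x, ‖x‖ ≤ R → ‖f x‖ ≤ C := by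
  obtain ⟨C, hC⟩ := (isCompact_closedBall (0 : E) R).exists_bound_of_continuousOn hf.continuousOn
  exact ⟨C, fun x hx => hC x (by simpa using hx)⟩

section LocalBounds

variable {E F : Type*} [NormedAddCommGroup E] [NormedSpace ℝ E] [NormedAddCommGroup F]
  [NormedSpace ℝ F] {U : E → F} {R B : ℝ}

/-- A differentiable map which on the closed ball of radius `R` about the origin is bounded by `B`
together with its derivative, and whose derivative is `B`-Lipschitz there. The normalization
`1 ≤ B` lets lower powers of `B` be absorbed into higher ones. -/
structure LocalBounds (U : E → F) (R B : ℝ) : Prop where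
  one_le : 1 ≤ B
  differentiable : Differentiable ℝ U
  norm_le : ∀ x, ‖x‖ ≤ R → ‖U x‖ ≤ B
  norm_fderiv_le : ∀ x, ‖x‖ ≤ R → ‖fderiv ℝ U x‖ ≤ B
  norm_fderiv_sub_le : ∀ x y, ‖x‖ ≤ R → ‖y‖ ≤ R → ‖fderiv ℝ U y - fderiv ℝ U x‖ ≤ B * ‖y - x‖

lemma norm_image_sub_le_of_norm_fderiv_le_of_norm_le {C : ℝ} (hU : Differentiable ℝ U)
    (hC : ∀ x, ‖x‖ ≤ R → ‖fderiv ℝ U x‖ ≤ C) {x y : E} (hx : ‖x‖ ≤ R) (hy : ‖y‖ ≤ R) :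
    ‖U y - U x‖ ≤ C * ‖y - x‖ :=
  (convex_closedBall (0 : E) R).norm_image_sub_le_of_norm_fderiv_le (𝕜 := ℝ) (fun z _ => hU z)
    (fun z hz => hC z (by simpa using hz)) (by simpa using hx) (by simpa using hy)

lemma exists_localBounds [ProperSpace E] (hU : ContDiff ℝ 2 U) (R : ℝ) :
    ∃ B, LocalBounds U R B := by
  have hJ : ContDiff ℝ 1 (fderiv ℝ U) := hU.fderiv_right (by norm_num)
  obtain ⟨C₀, h₀⟩ := exists_norm_le_of_continuous hU.continuous R
  obtain ⟨C₁, h₁⟩ := exists_norm_le_of_continuous hJ.continuous R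
  obtain ⟨C₂, h₂⟩ := exists_norm_le_of_continuous (hJ.continuous_fderiv one_ne_zero) R
  refine ⟨max (max C₀ C₁) (max C₂ 1), by simp, hU.differentiable two_ne_zero,
    fun x hx => (h₀ x hx).trans (by simp), fun x hx => (h₁ x hx).trans (by simp),
    fun x y hx hy => ?_⟩
  exact norm_image_sub_le_of_norm_fderiv_le_of_norm_le (hJ.differentiable one_ne_zero)
    (fun z hz => (h₂ z hz).trans (by simp)) hx hy

namespace LocalBounds

lemma pos (h : LocalBounds U R B) : 0 < B :=
  one_pos.trans_le h.one_le

lemma mono {R' B' : ℝ} (h : LocalBounds U R B) (hR : R' ≤ R) (hB : B ≤ B') :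
    LocalBounds U R' B' where
  one_le := h.one_le.trans hB
  differentiable := h.differentiable
  norm_le x hx := (h.norm_le x (hx.trans hR)).trans hB
  norm_fderiv_le x hx := (h.norm_fderiv_le x (hx.trans hR)).trans hB
  norm_fderiv_sub_le x y hx hy :=
    (h.norm_fderiv_sub_le x y (hx.trans hR) (hy.trans hR)).trans (by gcongr)

lemma norm_sub_le (h : LocalBounds U R B) {x y : E} (hx : ‖x‖ ≤ R) (hy : ‖y‖ ≤ R) :
    ‖U y - U x‖ ≤ B * ‖y - x‖ :=
  norm_image_sub_le_of_norm_fderiv_le_of_norm_le h.differentiable h.norm_fderiv_le hx hy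

lemma norm_sub_sub_fderiv_le (h : LocalBounds U R B) {x y : E} (hx : ‖x‖ ≤ R) (hy : ‖y‖ ≤ R) :
    ‖U y - U x - fderiv ℝ U x (y - x)‖ ≤ B * ‖y - x‖ ^ 2 := by
  have hball : ∀ z ∈ segment ℝ x y, ‖z‖ ≤ R := fun z hz => by
    simpa using (convex_closedBall (0 : E) R).segment_subset (by simpa using hx)
      (by simpa using hy) hz
  rw [pow_two, ← mul_assoc]
  refine (convex_segment x y).norm_image_sub_le_of_norm_fderiv_le' (𝕜 := ℝ)
    (fun z _ => h.differentiable z) (fun z hz => ?_) (left_mem_segment ℝ x y)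
    (right_mem_segment ℝ x y)
  have hzx : ‖z - x‖ ≤ ‖y - x‖ := norm_sub_le_of_mem_segment hz
  exact (h.norm_fderiv_sub_le x z hx (hball z hz)).trans
    (mul_le_mul_of_nonneg_left hzx h.pos.le)

lemma norm_second_difference_le (h : LocalBounds U R B) {x v : E} (hx : ‖x‖ ≤ R)
    (hadd : ‖x + v‖ ≤ R) (hsub : ‖x - v‖ ≤ R) :
    ‖U (x + v) + U (x - v) - (2 : ℝ) • U x‖ ≤ 2 * B * ‖v‖ ^ 2 := by
  have hp := h.norm_sub_sub_fderiv_le hx hadd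
  have hm := h.norm_sub_sub_fderiv_le hx hsub
  simp only [add_sub_cancel_left, sub_sub_cancel_left, map_neg, norm_neg] at hp hm
  calc ‖U (x + v) + U (x - v) - (2 : ℝ) • U x‖
      = ‖(U (x + v) - U x - fderiv ℝ U x v) + (U (x - v) - U x - -fderiv ℝ U x v)‖ := by
        congr 1; module
    _ ≤ B * ‖v‖ ^ 2 + B * ‖v‖ ^ 2 := norm_add_le_of_le hp hm
    _ = 2 * B * ‖v‖ ^ 2 := by ring

end LocalBounds

end LocalBounds

section SelfForce

variable {E : Type*} [NormedAddCommGroup E] [NormedSpace ℝ E]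

/-- The field `J_U U`, which is the gradient of `‖U‖² / 2` when `J_U` is symmetric. -/
def selfForce (U : E → E) (θ : E) : E :=
  fderiv ℝ U θ (U θ)

lemma contDiff_selfForce {U : E → E} (hU : ContDiff ℝ 2 U) : ContDiff ℝ 1 (selfForce U) :=
  (hU.fderiv_right (m := 1) (by norm_num)).clm_apply (hU.of_le (by norm_num))

/-- The hypotheses under which a field `U` with correction `P` is expanded to second order: `U` has
local bounds, and the correction is `O(η)` together with its derivative. -/
structure CorrectionBounds (U P : E → E) (R B η : ℝ) : Prop extends LocalBounds U R B where
  step_pos : 0 < η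
  step_small : η * (2 * B) ≤ 1
  differentiable_correction : Differentiable ℝ P
  norm_correction_le : ∀ x, ‖x‖ ≤ R → ‖P x‖ ≤ B * η
  norm_fderiv_correction_le : ∀ x, ‖x‖ ≤ R → ‖fderiv ℝ P x‖ ≤ B * η

lemma eventually_mul_le {ε : ℝ} (hε : 0 < ε) (B : ℝ) : ∀ᶠ η in 𝓝[>] (0 : ℝ), η * B ≤ ε := by
  have h : Tendsto (fun η : ℝ => η * B) (𝓝[>] 0) (𝓝 0) := by
    simpa using (continuous_mul_const B).tendsto' 0 0 (zero_mul B) |>.mono_left nhdsWithin_le_nhds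
  exact h.eventually_le_const hε

lemma exists_eventually_correctionBounds [ProperSpace E] {U : E → E} (hU : ContDiff ℝ 2 U)
    (R C : ℝ) :
    ∃ B, ∀ᶠ η in 𝓝[>] (0 : ℝ), ∀ P : E → E, Differentiable ℝ P →
      (∀ x, ‖x‖ ≤ R → ‖P x‖ ≤ C * η ∧ ‖fderiv ℝ P x‖ ≤ C * η) → CorrectionBounds U P R B η := by
  obtain ⟨B₀, hB₀⟩ := exists_localBounds hU R
  have hCB : C ≤ max B₀ C := le_max_right _ _
  refine ⟨max B₀ C, ?_⟩
  filter_upwards [self_mem_nhdsWithin, eventually_mul_le one_pos (2 * max B₀ C)]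
    with η (hη : 0 < η) hsmall P hP hbound
  exact ⟨hB₀.mono le_rfl (le_max_left _ _), hη, hsmall, hP,
    fun x hx => (hbound x hx).1.trans (by gcongr), fun x hx => (hbound x hx).2.trans (by gcongr)⟩

namespace CorrectionBounds

variable {U P : E → E} {R B η : ℝ}

lemma norm_add_lt (h : CorrectionBounds U P R B η) {x : E} (hx : ‖x‖ ≤ R) :
    ‖U x + P x‖ < 2 * B := by
  have := norm_add_le_of_le (h.norm_le x hx) (h.norm_correction_le x hx)
  nlinarith [h.step_small, h.pos, h.one_le]

/-- To this order only `U`, and not its correction, contributes to the increment. -/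
lemma norm_sub_add_selfForce_le (h : CorrectionBounds U P R B η) {θ y : E} {r s δ : ℝ}
    (hr : r ≤ η) (hθ : ‖θ‖ ≤ R) (hy : ‖y‖ ≤ R) (hnear : ‖y - θ‖ ≤ 2 * B * r)
    (hstep : ‖y - θ + s • U θ‖ ≤ δ) :
    ‖(U y + P y) - (U θ + P θ) + s • selfForce U θ‖ ≤ 6 * B ^ 3 * (r * η) + B * δ := by
  have hB := h.one_le
  have hBr : 0 ≤ 2 * B * r := (norm_nonneg _).trans hnear
  have hr0 : 0 ≤ r := nonneg_of_mul_nonneg_right hBr (by linarith)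
  have taylor : ‖U y - U θ - fderiv ℝ U θ (y - θ)‖ ≤ B * (2 * B * r) ^ 2 :=
    (h.norm_sub_sub_fderiv_le hθ hy).trans (by gcongr)
  have linear : ‖fderiv ℝ U θ (y - θ + s • U θ)‖ ≤ B * δ :=
    (fderiv ℝ U θ).le_of_opNorm_le_of_le (h.norm_fderiv_le θ hθ) hstep
  have correction : ‖P y - P θ‖ ≤ B * η * (2 * B * r) :=
    (norm_image_sub_le_of_norm_fderiv_le_of_norm_le h.differentiable_correction
      h.norm_fderiv_correction_le hθ hy).trans
      (mul_le_mul_of_nonneg_left hnear (mul_nonneg h.pos.le h.step_pos.le))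
  calc ‖(U y + P y) - (U θ + P θ) + s • selfForce U θ‖
      = ‖(U y - U θ - fderiv ℝ U θ (y - θ)) + fderiv ℝ U θ (y - θ + s • U θ) + (P y - P θ)‖ := by
        simp only [selfForce, map_add, map_smul]
        congr 1
        module
    _ ≤ B * (2 * B * r) ^ 2 + B * δ + B * η * (2 * B * r) :=
        norm_add_le_of_le (norm_add_le_of_le taylor linear) correction
    _ = 4 * B ^ 3 * (r * r) + 2 * B ^ 2 * (r * η) + B * δ := by ring
    _ ≤ 4 * B ^ 3 * (r * η) + 2 * B ^ 3 * (r * η) + B * δ := by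
        have := h.step_pos
        gcongr
        norm_num
    _ = 6 * B ^ 3 * (r * η) + B * δ := by ring

end CorrectionBounds

end SelfForce

section Asymptotics

lemma exists_pos_forall_lt_iff_eventually {p : ℝ → Prop} :
    (∃ η₀ : ℝ, 0 < η₀ ∧ ∀ η : ℝ, 0 < η → η < η₀ → p η) ↔ ∀ᶠ η in 𝓝[>] 0, p η :=
  ((nhdsGT_basis (0 : ℝ)).eventually_iff.trans
    (exists_congr fun _ => and_congr_right fun _ => by simp only [Set.mem_Ioo, and_imp])).symm

lemma forall_isCompact_iff_forall_norm_le {E : Type*} [NormedAddCommGroup E] [ProperSpace E]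
    {p : ℝ → ℝ → E → Prop} :
    (∀ K : Set E, IsCompact K → ∃ C η₀ : ℝ, 0 < η₀ ∧
      ∀ η : ℝ, 0 < η → η < η₀ → ∀ θ ∈ K, p C η θ) ↔
    ∀ R : ℝ, ∃ C, ∀ᶠ η in 𝓝[>] 0, ∀ θ, ‖θ‖ ≤ R → p C η θ := by
  simp only [exists_pos_forall_lt_iff_eventually]
  refine ⟨fun h R => by simpa using h _ (isCompact_closedBall (0 : E) R), fun h K hK => ?_⟩
  obtain ⟨R, hR⟩ := hK.isBounded.exists_norm_le
  obtain ⟨C, hC⟩ := h R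
  exact ⟨C, hC.mono fun η hη θ hθ => hη θ (hR θ hθ)⟩

variable {d : ℕ} {F : Type*} {m : ℕ} {r s : ℝ → Param d → F}

lemma locO_iff [Norm F] :
    LocO m r ↔ ∀ R : ℝ, ∃ C, ∀ᶠ η in 𝓝[>] 0, ∀ θ, ‖θ‖ ≤ R → ‖r η θ‖ ≤ C * η ^ m :=
  forall_isCompact_iff_forall_norm_le

lemma LocO.congr [Norm F] (hr : LocO m r) (hrs : ∀ η, 0 < η → ∀ θ, r η θ = s η θ) :
    LocO m s := by
  intro K hK
  obtain ⟨C, η₀, hη₀, h⟩ := hr K hK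
  exact ⟨C, η₀, hη₀, fun η hη hlt θ hθ => hrs η hη θ ▸ h η hη hlt θ hθ⟩

lemma LocO.add [SeminormedAddCommGroup F] (hr : LocO m r) (hs : LocO m s) :
    LocO m fun η θ => r η θ + s η θ := by
  refine locO_iff.2 fun R => ?_
  obtain ⟨C, hC⟩ := locO_iff.1 hr R
  obtain ⟨C', hC'⟩ := locO_iff.1 hs R
  refine ⟨C + C', ?_⟩
  filter_upwards [hC, hC'] with η h h' θ hθ
  rw [add_mul]
  exact norm_add_le_of_le (h θ hθ) (h' θ hθ)

variable [NormedAddCommGroup F] [NormedSpace ℝ F]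

lemma LocO.const_smul (hr : LocO m r) (a : ℝ) : LocO m fun η θ => a • r η θ := by
  intro K hK
  obtain ⟨C, η₀, hη₀, h⟩ := hr K hK
  refine ⟨‖a‖ * C, η₀, hη₀, fun η hη hlt θ hθ => ?_⟩
  rw [norm_smul, mul_assoc]
  exact mul_le_mul_of_nonneg_left (h η hη hlt θ hθ) (norm_nonneg a)

lemma LocO.of_smul (hr : LocO (m + 1) fun η θ => η • r η θ) : LocO m r := by
  intro K hK
  obtain ⟨C, η₀, hη₀, h⟩ := hr K hK
  refine ⟨C, η₀, hη₀, fun η hη hlt θ hθ => le_of_mul_le_mul_left ?_ hη⟩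
  calc η * ‖r η θ‖ = ‖η • r η θ‖ := by rw [norm_smul, Real.norm_of_nonneg hη.le]
    _ ≤ C * η ^ (m + 1) := h η hη hlt θ hθ
    _ = η * (C * η ^ m) := by ring

lemma locO_mul_smul_of_continuous {f : Param d → F} (hf : Continuous f) (a : ℝ) :
    LocO 1 fun η θ => (a * η) • f θ := by
  refine locO_iff.2 fun R => ?_
  obtain ⟨C, hC⟩ := exists_norm_le_of_continuous hf R
  refine ⟨‖a‖ * C, ?_⟩
  filter_upwards [self_mem_nhdsWithin] with η (hη : 0 < η) θ hθ
  calc ‖(a * η) • f θ‖ = ‖a‖ * η * ‖f θ‖ := by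
        rw [norm_smul, norm_mul, Real.norm_of_nonneg hη.le]
    _ ≤ ‖a‖ * η * C := by gcongr; exact hC θ hθ
    _ = ‖a‖ * C * η ^ 1 := by ring

end Asymptotics

variable {d : ℕ} {U : Param d → Param d}

section Leading

lemma contDiff_leading (hU : ContDiff ℝ 2 U) (η : ℝ) : ContDiff ℝ 2 (leading U η) :=
  contDiff_const.mul (hU.norm_sq ℝ)

lemma hasGradientAt_leading (hU : Differentiable ℝ U) (hsym : SymmetricJacobian U) (η : ℝ)
    (θ : Param d) : HasGradientAt (leading U η) ((η / 2) • selfForce U θ) θ := by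
  rw [hasGradientAt_iff_hasFDerivAt]
  refine ((hU θ).hasFDerivAt.norm_sq.const_mul (η / 4)).congr_fderiv ?_
  ext v
  have hJ : inner ℝ (fderiv ℝ U θ (U θ)) v = inner ℝ (U θ) (fderiv ℝ U θ v) := hsym θ (U θ) v
  simp only [selfForce, map_smul, smul_apply, nsmul_eq_mul, Nat.cast_ofNat, smul_eq_mul,
    ContinuousLinearMap.comp_apply, innerSL_apply_apply, InnerProductSpace.toDual_apply_apply, hJ]
  ring

lemma gradient_leading (hU : Differentiable ℝ U) (hsym : SymmetricJacobian U) (η : ℝ) :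
    gradient (leading U η) = fun θ => (η / 2) • selfForce U θ :=
  funext fun θ => (hasGradientAt_leading hU hsym η θ).gradient

lemma eqLeadingUpToConst_of_gradient (hU : Differentiable ℝ U) (hsym : SymmetricJacobian U)
    {φ : ℝ → Param d → ℝ} (hφ : ∀ η : ℝ, 0 < η → Differentiable ℝ (φ η))
    (h : LocO 2 fun η θ => gradient (φ η) θ - (η / 2) • selfForce U θ) :
    EqLeadingUpToConst U φ := by
  refine ⟨fun η => leading U η 0 - φ η 0, locO_iff.2 fun R => ?_⟩
  obtain ⟨C, hC⟩ := locO_iff.1 h R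
  refine ⟨C * R, ?_⟩
  filter_upwards [self_mem_nhdsWithin, hC] with η (hη : 0 < η) hgrad θ hθ
  have hR : 0 ≤ R := (norm_nonneg θ).trans hθ
  have hCη : 0 ≤ C * η ^ 2 := (norm_nonneg _).trans (hgrad θ hθ)
  have hderiv : ∀ x, HasFDerivAt (fun y => φ η y - leading U η y)
      (InnerProductSpace.toDual ℝ _ (gradient (φ η) x - (η / 2) • selfForce U x)) x := fun x => by
    rw [map_sub]
    exact (hφ η hη x).hasGradientAt.hasFDerivAt.sub
      (hasGradientAt_leading hU hsym η x).hasFDerivAt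
  have hmean := (convex_closedBall (0 : Param d) R).norm_image_sub_le_of_norm_hasFDerivWithin_le
    (C := C * η ^ 2) (x := 0) (y := θ) (fun x _ => (hderiv x).hasFDerivWithinAt)
    (fun x hx => by
      rw [LinearIsometryEquiv.norm_map]
      exact hgrad x (by simpa using hx))
    (by simpa using hR) (by simpa using hθ)
  calc ‖φ η θ + (leading U η 0 - φ η 0) - leading U η θ‖
      = ‖φ η θ - leading U η θ - (φ η 0 - leading U η 0)‖ := by congr 1; ring
    _ ≤ C * η ^ 2 * ‖θ‖ := by simpa using hmean
    _ ≤ C * η ^ 2 * R := by gcongr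
    _ = C * R * η ^ 2 := by ring

end Leading

/-! ### Time reversal asymmetry -/

section TimeReversal

lemma locO_sub_recovered (hU : ContDiff ℝ 2 U) :
    LocO 3 fun η θ => θ - recovered U η θ - η ^ 2 • selfForce U θ := by
  refine locO_iff.2 fun R => ?_
  obtain ⟨B, hB⟩ := exists_localBounds hU (R + 1)
  refine ⟨B ^ 3, ?_⟩
  filter_upwards [self_mem_nhdsWithin, eventually_mul_le one_pos B] with η (hη : 0 < η) hηB θ hθ
  have hB0 := hB.pos
  have hstep : ‖η • U θ‖ ≤ η * B := by
    rw [norm_smul, Real.norm_of_nonneg hη.le]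
    gcongr
    exact hB.norm_le θ (by linarith)
  have hupdate : ‖update U η θ‖ ≤ R + 1 := norm_sub_le_of_le hθ (hstep.trans hηB)
  have hdiff : update U η θ - θ = -(η • U θ) := by simp only [update]; abel
  have htaylor := hB.norm_sub_sub_fderiv_le (by linarith : ‖θ‖ ≤ R + 1) hupdate
  rw [hdiff, norm_neg] at htaylor
  calc ‖θ - recovered U η θ - η ^ 2 • selfForce U θ‖
      = ‖-(η • (U (update U η θ) - U θ - fderiv ℝ U θ (-(η • U θ))))‖ := by
        simp only [recovered, selfForce, map_neg, map_smul]
        congr 1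
        module
    _ = η * ‖U (update U η θ) - U θ - fderiv ℝ U θ (-(η • U θ))‖ := by
        rw [norm_neg, norm_smul, Real.norm_of_nonneg hη.le]
    _ ≤ η * (B * (η * B) ^ 2) := by
        gcongr
        exact htaylor.trans (by gcongr)
    _ = B ^ 3 * η ^ 3 := by ring

lemma locO_asymmetryForce_sub (hU : ContDiff ℝ 2 U) :
    LocO 2 fun η θ => (2 * η)⁻¹ • (θ - recovered U η θ) - (η / 2) • selfForce U θ := by
  refine LocO.of_smul (((locO_sub_recovered hU).const_smul 2⁻¹).congr fun η hη θ => ?_)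
  generalize θ - recovered U η θ = v
  match_scalars <;> field_simp

lemma isTAPotential_leading (hU : ContDiff ℝ 2 U) (hsym : SymmetricJacobian U) :
    IsTAPotential U (leading U) where
  smooth η _ := (contDiff_leading hU η).differentiable two_ne_zero
  force := ((locO_sub_recovered hU).const_smul (-1)).congr fun η _ θ => by
    rw [gradient_leading (hU.differentiable two_ne_zero) hsym]
    module

lemma IsTAPotential.eqLeadingUpToConst (hU : ContDiff ℝ 2 U) (hsym : SymmetricJacobian U)
    {φ : ℝ → Param d → ℝ} (h : IsTAPotential U φ) : EqLeadingUpToConst U φ := by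
  refine eqLeadingUpToConst_of_gradient (hU.differentiable two_ne_zero) hsym h.smooth
    (LocO.of_smul (((h.force.add (locO_sub_recovered hU)).const_smul 2⁻¹).congr fun η _ θ => ?_))
  module

lemma norm_integral_inner_segment_sub_le {E : Type*} [NormedAddCommGroup E] [InnerProductSpace ℝ E]
    [CompleteSpace E] {f : E → ℝ} {g G : E → E} (hf : ∀ x, HasGradientAt f (g x) x)
    (hg : Continuous g) (hG : Continuous G) {a b : E} {ε : ℝ}
    (hε : ∀ x ∈ segment ℝ a b, ‖G x - g x‖ ≤ ε) :
    ‖(∫ s in (0 : ℝ)..1, inner ℝ (G (a + s • (b - a))) (b - a)) - (f b - f a)‖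
      ≤ ε * ‖b - a‖ := by
  have hderiv : ∀ s : ℝ, HasDerivAt (fun s : ℝ => f (a + s • (b - a)))
      (inner ℝ (g (a + s • (b - a))) (b - a)) s := fun s => by
    have hline : HasDerivAt (fun s : ℝ => a + s • (b - a)) (b - a) s := by
      simpa using ((hasDerivAt_id s).smul_const (b - a)).const_add a
    simpa [Function.comp_def] using (hf _).hasFDerivAt.comp_hasDerivAt s hline
  have hcont : ∀ H : E → E, Continuous H → IntervalIntegrable
      (fun s : ℝ => inner ℝ (H (a + s • (b - a))) (b - a)) volume 0 1 := fun H hH =>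
    (by fun_prop : Continuous fun s : ℝ => inner ℝ (H (a + s • (b - a))) (b - a)).intervalIntegrable
      0 1
  have hftc : ∫ s in (0 : ℝ)..1, inner ℝ (g (a + s • (b - a))) (b - a) = f b - f a := by
    simpa using intervalIntegral.integral_eq_sub_of_hasDerivAt (fun s _ => hderiv s) (hcont g hg)
  rw [← hftc, ← intervalIntegral.integral_sub (hcont G hG) (hcont g hg)]
  refine (intervalIntegral.norm_integral_le_of_norm_le_const (C := ε * ‖b - a‖)
    fun s hs => ?_).trans_eq (by simp)
  rw [Set.uIoc_of_le zero_le_one] at hs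
  rw [← inner_sub_left]
  refine (norm_inner_le_norm _ _).trans (mul_le_mul_of_nonneg_right (hε _ ?_) (norm_nonneg _))
  rw [segment_eq_image']
  exact ⟨s, ⟨hs.1.le, hs.2⟩, rfl⟩

lemma continuous_recovered (hU : Continuous U) (η : ℝ) : Continuous (recovered U η) := by
  unfold recovered update
  fun_prop

lemma taLinePotential_eqLeading (hU : ContDiff ℝ 2 U) (hsym : SymmetricJacobian U)
    (θref : Param d) : EqLeading U fun η θ => taLinePotential U θref η θ + leading U η θref := by
  refine locO_iff.2 fun R => ?_
  obtain ⟨C, hC⟩ := locO_iff.1 (locO_asymmetryForce_sub hU) (max R ‖θref‖)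
  refine ⟨C * (R + ‖θref‖), ?_⟩
  filter_upwards [hC] with η hforce θ hθ
  have hCη : 0 ≤ C * η ^ 2 := (norm_nonneg _).trans (hforce θref (le_max_right _ _))
  have hsegment : ∀ x ∈ segment ℝ θref θ, ‖x‖ ≤ max R ‖θref‖ := fun x hx => by
    simpa using (convex_closedBall (0 : Param d) (max R ‖θref‖)).segment_subset
      (by simp) (by simp [hθ]) hx
  have hrec := continuous_recovered hU.continuous η
  have hline := norm_integral_inner_segment_sub_le
    (hasGradientAt_leading (hU.differentiable two_ne_zero) hsym η)
    ((contDiff_selfForce hU).continuous.const_smul (η / 2))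
    (by fun_prop : Continuous fun x => (2 * η)⁻¹ • (x - recovered U η x))
    (fun x hx => hforce x (hsegment x hx))
  calc ‖taLinePotential U θref η θ + leading U η θref - leading U η θ‖
      = ‖taLinePotential U θref η θ - (leading U η θ - leading U η θref)‖ := by congr 1; ring
    _ ≤ C * η ^ 2 * ‖θ - θref‖ := hline
    _ ≤ C * η ^ 2 * (R + ‖θref‖) := by gcongr; exact norm_sub_le_of_le hθ le_rfl
    _ = C * (R + ‖θref‖) * η ^ 2 := by ring

end TimeReversal

/-! ### Discretization error -/

section DiscretizationError

variable {V P : Param d → Param d} {η T R B M : ℝ} {θ : Param d} {γ : ℝ → Param d}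

lemma IsFlowLine.continuousOn (h : IsFlowLine V η T θ γ) : ContinuousOn γ (Set.Icc 0 T) :=
  fun s hs => (h.2 s hs).continuousWithinAt

lemma IsFlowLine.shift {t S : ℝ} (h : IsFlowLine V η T θ γ) (ht : 0 ≤ t) (hS : t + S ≤ T) :
    IsFlowLine V η S (γ t) fun s => γ (t + s) := by
  refine ⟨by simp, fun s hs => ?_⟩
  have hmaps : Set.MapsTo (fun s => t + s) (Set.Icc 0 S) (Set.Icc 0 T) :=
    fun x hx => ⟨add_nonneg ht hx.1, by linarith [hx.2]⟩
  simpa [Function.comp_def] using (h.2 (t + s) (hmaps hs)).scomp s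
    ((hasDerivAt_id s).const_add t).hasDerivWithinAt hmaps

lemma IsFlowLine.norm_sub_le (h : IsFlowLine V η T θ γ) (hη : 0 < η)
    (hM : ∀ x, ‖x‖ ≤ R + 1 → ‖V x‖ < M) (hθ : ‖θ‖ ≤ R) (hT : η * M * T ≤ 1) :
    ∀ s ∈ Set.Icc (0 : ℝ) T, ‖γ s - θ‖ ≤ η * M * s := by
  have hM0 : 0 < M := (norm_nonneg _).trans_lt (hM θ (by linarith))
  intro s hs
  refine image_norm_le_of_norm_deriv_right_lt_deriv_boundary (f := fun s => γ s - θ)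
    (f' := fun s => -(η • V (γ s))) (a := 0) (b := T) (B := fun s => η * M * s)
    (B' := fun _ => η * M) (h.continuousOn.sub continuousOn_const) (fun x hx => ?_) (by simp [h.1])
    (fun x => by simpa using (hasDerivAt_id x).const_mul (η * M)) (fun x hx hxe => ?_) hs
  · exact ((h.2 x ⟨hx.1, hx.2.le⟩).sub_const θ).mono_of_mem_nhdsWithin
      (mem_of_superset (Icc_mem_nhdsGE hx.2) (Set.Icc_subset_Icc_left hx.1))
  · have hstay : η * M * x ≤ 1 := by
      refine le_trans ?_ hT
      gcongr
      exact hx.2.le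
    have hγx : ‖γ x‖ ≤ R + 1 := by
      have := norm_le_norm_add_norm_sub' (γ x) θ
      linarith
    rw [norm_neg, norm_smul, Real.norm_of_nonneg hη.le]
    exact mul_lt_mul_of_pos_left (hM _ hγx) hη

lemma IsFlowLine.norm_sub_quadratic_le (h : IsFlowLine V η T θ γ) {a b : Param d} {C : ℝ}
    (hC : ∀ s ∈ Set.Ico 0 T, ‖η • V (γ s) - (a + (2 * s) • b)‖ ≤ C) :
    ∀ s ∈ Set.Icc (0 : ℝ) T, ‖γ s - (θ - s • a - s ^ 2 • b)‖ ≤ C * s := by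
  intro s hs
  have hderiv : ∀ x ∈ Set.Icc (0 : ℝ) T, HasDerivWithinAt
      (fun x => γ x - (θ - x • a - x ^ 2 • b)) (-(η • V (γ x) - (a + (2 * x) • b)))
      (Set.Icc 0 T) x := fun x hx => by
    have hlin : HasDerivAt (fun x : ℝ => x • a) a x := by
      simpa using (hasDerivAt_id x).smul_const a
    have hquad : HasDerivAt (fun x : ℝ => x ^ 2 • b) ((2 * x) • b) x := by
      simpa using (hasDerivAt_pow 2 x).smul_const b
    exact ((h.2 x hx).sub ((hlin.const_sub θ).sub hquad).hasDerivWithinAt).congr_deriv (by abel)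
  have := norm_image_sub_le_of_norm_deriv_le_segment' hderiv
    (fun x hx => (norm_neg _).trans_le (hC x hx)) s hs
  simpa [h.1] using this

lemma IsFlowLine.norm_sub_le_of_correctionBounds (hB : CorrectionBounds U P (R + 1) B η)
    (hθ : ‖θ‖ ≤ R) (h : IsFlowLine (fun x => U x + P x) η 1 θ γ) {s : ℝ}
    (hs : s ∈ Set.Icc (0 : ℝ) 1) : ‖γ s - θ‖ ≤ 2 * B * η :=
  calc ‖γ s - θ‖ ≤ η * (2 * B) * s :=
        h.norm_sub_le hB.step_pos (fun _ hx => hB.norm_add_lt hx) hθ (by linarith [hB.step_small])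
          s hs
    _ ≤ η * (2 * B) := mul_le_of_le_one_right (mul_pos hB.step_pos (by linarith [hB.pos])).le hs.2
    _ = 2 * B * η := mul_comm _ _

lemma IsFlowLine.norm_le_of_correctionBounds (hB : CorrectionBounds U P (R + 1) B η)
    (hθ : ‖θ‖ ≤ R) (h : IsFlowLine (fun x => U x + P x) η 1 θ γ) {s : ℝ}
    (hs : s ∈ Set.Icc (0 : ℝ) 1) : ‖γ s‖ ≤ R + 1 := by
  have := norm_le_norm_add_norm_sub' (γ s) θ
  linarith [h.norm_sub_le_of_correctionBounds hB hθ hs, hB.step_small]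

lemma IsFlowLine.norm_sub_add_smul_le (hB : CorrectionBounds U P (R + 1) B η) (hθ : ‖θ‖ ≤ R)
    (h : IsFlowLine (fun x => U x + P x) η 1 θ γ) {s : ℝ} (hs : s ∈ Set.Icc (0 : ℝ) 1) :
    ‖γ s - θ + (s * η) • U θ‖ ≤ 3 * B ^ 2 * η ^ 2 := by
  have hη := hB.step_pos
  have hlin := h.norm_sub_quadratic_le (a := η • U θ) (b := 0) (C := 3 * B ^ 2 * η ^ 2)
    (fun x hx => ?_) s hs
  · calc ‖γ s - θ + (s * η) • U θ‖ = ‖γ s - (θ - s • η • U θ - s ^ 2 • (0 : Param d))‖ := by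
          congr 1; module
      _ ≤ 3 * B ^ 2 * η ^ 2 * s := hlin
      _ ≤ 3 * B ^ 2 * η ^ 2 := mul_le_of_le_one_right (by positivity) hs.2
  · have hx' : x ∈ Set.Icc (0 : ℝ) 1 := ⟨hx.1, hx.2.le⟩
    have hγx := h.norm_le_of_correctionBounds hB hθ hx'
    calc ‖η • (U (γ x) + P (γ x)) - (η • U θ + (2 * x) • (0 : Param d))‖
        = ‖η • ((U (γ x) - U θ) + P (γ x))‖ := by congr 1; module
      _ = η * ‖(U (γ x) - U θ) + P (γ x)‖ := by rw [norm_smul, Real.norm_of_nonneg hη.le]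
      _ ≤ η * (B * (2 * B * η) + B * η) := by
          have hB0 := hB.pos
          gcongr
          refine norm_add_le_of_le ((hB.norm_sub_le (by linarith) hγx).trans ?_)
            (hB.norm_correction_le _ hγx)
          gcongr
          exact h.norm_sub_le_of_correctionBounds hB hθ hx'
      _ = 2 * B ^ 2 * η ^ 2 + B * η ^ 2 := by ring
      _ ≤ 2 * B ^ 2 * η ^ 2 + B ^ 2 * η ^ 2 := by
          gcongr
          exact le_self_pow₀ hB.one_le two_ne_zero
      _ = 3 * B ^ 2 * η ^ 2 := by ring

lemma IsFlowLine.norm_apply_one_sub_le (hB : CorrectionBounds U P (R + 1) B η) (hθ : ‖θ‖ ≤ R)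
    (h : IsFlowLine (fun x => U x + P x) η 1 θ γ) :
    ‖γ 1 - (update U η θ - η • (P θ - (η / 2) • selfForce U θ))‖ ≤ 9 * B ^ 3 * η ^ 3 := by
  have hη := hB.step_pos
  have hquad := h.norm_sub_quadratic_le (a := η • (U θ + P θ))
    (b := -(η ^ 2 / 2) • selfForce U θ) (C := 9 * B ^ 3 * η ^ 3) (fun x hx => ?_) 1 (by simp)
  · calc ‖γ 1 - (update U η θ - η • (P θ - (η / 2) • selfForce U θ))‖
        = ‖γ 1 - (θ - (1 : ℝ) • η • (U θ + P θ)
            - (1 : ℝ) ^ 2 • -(η ^ 2 / 2) • selfForce U θ)‖ := by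
          simp only [update]
          congr 1; module
      _ ≤ 9 * B ^ 3 * η ^ 3 := by simpa using hquad
  · have hx' : x ∈ Set.Icc (0 : ℝ) 1 := ⟨hx.1, hx.2.le⟩
    calc ‖η • (U (γ x) + P (γ x)) - (η • (U θ + P θ) + (2 * x) • -(η ^ 2 / 2) • selfForce U θ)‖
        = ‖η • ((U (γ x) + P (γ x)) - (U θ + P θ) + (x * η) • selfForce U θ)‖ := by
          congr 1; module
      _ = η * ‖(U (γ x) + P (γ x)) - (U θ + P θ) + (x * η) • selfForce U θ‖ := by
          rw [norm_smul, Real.norm_of_nonneg hη.le]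
      _ ≤ η * (6 * B ^ 3 * (η * η) + B * (3 * B ^ 2 * η ^ 2)) := by
          gcongr
          exact hB.norm_sub_add_selfForce_le le_rfl (by linarith)
            (h.norm_le_of_correctionBounds hB hθ hx') (h.norm_sub_le_of_correctionBounds hB hθ hx')
            (h.norm_sub_add_smul_le hB hθ hx')
      _ = 9 * B ^ 3 * η ^ 3 := by ring

lemma differentiable_gradient {E : Type*} [NormedAddCommGroup E] [InnerProductSpace ℝ E]
    [CompleteSpace E] {φ : E → ℝ} (hφ : ContDiff ℝ 2 φ) : Differentiable ℝ (gradient φ) := by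
  have h : Differentiable ℝ (fderiv ℝ φ) :=
    (hφ.fderiv_right (m := 1) (by norm_num)).differentiable one_ne_zero
  exact (InnerProductSpace.toDual ℝ E).symm.toContinuousLinearEquiv.differentiable.comp h

lemma exists_eventually_correctionBounds_of_locO (hU : ContDiff ℝ 2 U)
    {P : ℝ → Param d → Param d} (hd : ∀ η : ℝ, 0 < η → Differentiable ℝ (P η)) (hP : LocO 1 P)
    (hDP : LocO 1 fun η θ => fderiv ℝ (P η) θ) (R : ℝ) :
    ∃ B, ∀ᶠ η in 𝓝[>] (0 : ℝ), CorrectionBounds U (P η) R B η := by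
  obtain ⟨C, hC⟩ := locO_iff.1 hP R
  obtain ⟨C', hC'⟩ := locO_iff.1 hDP R
  obtain ⟨B, hB⟩ := exists_eventually_correctionBounds hU R (max C C')
  refine ⟨B, ?_⟩
  filter_upwards [self_mem_nhdsWithin, hC, hC', hB] with η (hη : 0 < η) h h' hη_bounds
  refine hη_bounds (P η) (hd η hη) fun x hx => ⟨?_, ?_⟩
  · calc ‖P η x‖ ≤ C * η ^ 1 := h x hx
      _ ≤ max C C' * η := by rw [pow_one]; gcongr; exact le_max_left _ _
  · calc ‖fderiv ℝ (P η) x‖ ≤ C' * η ^ 1 := h' x hx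
      _ ≤ max C C' * η := by rw [pow_one]; gcongr; exact le_max_right _ _

lemma IsDEPotential.eqLeadingUpToConst (hU : ContDiff ℝ 2 U) (hsym : SymmetricJacobian U)
    {φ : ℝ → Param d → ℝ} (h : IsDEPotential U φ) : EqLeadingUpToConst U φ := by
  refine eqLeadingUpToConst_of_gradient (hU.differentiable two_ne_zero) hsym
    (fun η hη => (h.smooth η hη).differentiable two_ne_zero) (LocO.of_smul (locO_iff.2 fun R => ?_))
  obtain ⟨B, hB⟩ := exists_eventually_correctionBounds_of_locO hU
    (fun η hη => differentiable_gradient (h.smooth η hη)) h.force_small h.deriv_small (R + 1)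
  obtain ⟨C, hC⟩ := forall_isCompact_iff_forall_norm_le.1 (h.matching 1) R
  refine ⟨C + 9 * B ^ 3, ?_⟩
  filter_upwards [hB, hC] with η hη hmatch θ hθ
  obtain ⟨γ, hγ, ht⟩ := hmatch θ hθ
  rw [Nat.cast_one] at hγ
  have hiterate : ‖update U η θ - γ 1‖ ≤ C * η ^ 3 := by simpa using ht 1 le_rfl
  calc ‖η • (gradient (φ η) θ - (η / 2) • selfForce U θ)‖
      = ‖(update U η θ - γ 1) +
          (γ 1 - (update U η θ - η • (gradient (φ η) θ - (η / 2) • selfForce U θ)))‖ := by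
        congr 1; module
    _ ≤ C * η ^ 3 + 9 * B ^ 3 * η ^ 3 :=
        norm_add_le_of_le hiterate (hγ.norm_apply_one_sub_le hη hθ)
    _ = (C + 9 * B ^ 3) * η ^ 3 := by ring

lemma exists_isFlowLine (hV : ContDiff ℝ 1 V) (hη : 0 < η) (hT : 0 ≤ T)
    (hM : ∀ x, ‖x‖ ≤ R + 1 → ‖V x‖ ≤ M) (hηM : η * M * T ≤ 1) (hθ : ‖θ‖ ≤ R) :
    ∃ γ, IsFlowLine V η T θ γ := by
  have hM0 : 0 ≤ M := (norm_nonneg _).trans (hM θ (by linarith))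
  have hsmul : ContDiff ℝ 1 fun x => -(η • V x) := (hV.const_smul η).neg
  have hball : ∀ x ∈ Metric.closedBall θ 1, ‖x‖ ≤ R + 1 := fun x hx => by
    have := norm_le_norm_add_norm_sub' x θ
    rw [mem_closedBall_iff_norm] at hx
    linarith
  obtain ⟨L, hL⟩ := exists_norm_le_of_continuous (hsmul.continuous_fderiv one_ne_zero) (R + 1)
  have hlip : LipschitzOnWith L.toNNReal (fun x => -(η • V x)) (Metric.closedBall θ 1) :=
    (convex_closedBall θ 1).lipschitzOnWith_of_nnnorm_fderiv_le (𝕜 := ℝ)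
      (fun z _ => hsmul.differentiable one_ne_zero z) fun z hz => by
        rw [← norm_toNNReal]
        exact Real.toNNReal_le_toNNReal (hL z (hball z hz))
  have hpl : IsPicardLindelof (fun _ x => -(η • V x)) (tmin := 0) (tmax := T)
      ⟨0, le_rfl, hT⟩ θ 1 0 (⟨η * M, by positivity⟩ : NNReal) L.toNNReal :=
    { lipschitzOnWith := fun t _ => by simpa using hlip
      continuousOn := fun x _ => continuousOn_const
      norm_le := fun t _ x hx => by
        rw [norm_neg, norm_smul, Real.norm_of_nonneg hη.le]
        exact mul_le_mul_of_nonneg_left (hM x (hball x (by simpa using hx))) hη.le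
      mul_max_le := by
        change η * M * max (T - 0) (0 - 0) ≤ 1 - 0
        simpa [hT] using hηM }
  exact hpl.exists_eq_forall_mem_Icc_hasDerivWithinAt₀

lemma dist_iterate_le {X : Type*} [PseudoMetricSpace X] {f : X → X} {K : NNReal}
    (hf : LipschitzWith K f) {y : ℕ → X} {ε : ℝ} {N : ℕ}
    (hy : ∀ t < N, dist (f (y t)) (y (t + 1)) ≤ ε) {t : ℕ} (ht : t ≤ N) :
    dist (f^[t] (y 0)) (y t) ≤ (∑ i ∈ Finset.range t, (K : ℝ) ^ i) * ε := by
  induction t with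
  | zero => simp
  | succ t ih =>
    rw [Function.iterate_succ_apply', geom_sum_succ]
    calc dist (f (f^[t] (y 0))) (y (t + 1))
        ≤ dist (f (f^[t] (y 0))) (f (y t)) + dist (f (y t)) (y (t + 1)) := dist_triangle _ _ _
      _ ≤ K * ((∑ i ∈ Finset.range t, (K : ℝ) ^ i) * ε) + ε := by
          gcongr
          · exact hf.dist_le_mul_of_le (ih (by omega))
          · exact hy t (by omega)
      _ = (K * ∑ i ∈ Finset.range t, (K : ℝ) ^ i + 1) * ε := by ring

lemma lipschitzWith_update {Λ : NNReal} (hLip : LipschitzWith Λ U) (hη : |η| ≤ 1) :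
    LipschitzWith (1 + Λ) (update U η) := by
  refine (LipschitzWith.id.sub ((lipschitzWith_smul η).comp hLip)).weaken ?_
  gcongr
  exact mul_le_of_le_one_left zero_le (by simpa [← NNReal.coe_le_coe] using hη)

lemma IsFlowLine.norm_iterate_sub_le {Λ : NNReal} (hLip : LipschitzWith Λ U) {N : ℕ}
    (hB : CorrectionBounds U (fun x => (η / 2) • selfForce U x) (R + 1 + 1) B η)
    (hηN : η * (2 * B) * N ≤ 1) (hθ : ‖θ‖ ≤ R)
    (h : IsFlowLine (fun x => U x + (η / 2) • selfForce U x) η N θ γ) {t : ℕ} (ht : t ≤ N) :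
    ‖(update U η)^[t] θ - γ t‖
      ≤ (∑ i ∈ Finset.range t, (1 + Λ : ℝ) ^ i) * (9 * B ^ 3 * η ^ 3) := by
  have hη := hB.step_pos
  have hη1 : |η| ≤ 1 := by
    rw [abs_of_pos hη]
    nlinarith [hB.step_small, hB.one_le]
  have ball : ∀ t : ℕ, t ≤ N → ‖γ t‖ ≤ R + 1 := fun t ht => by
    have htN : (t : ℝ) ≤ N := by exact_mod_cast ht
    have hconfined : ‖γ t - θ‖ ≤ η * (2 * B) * t :=
      h.norm_sub_le hη (fun x hx => hB.norm_add_lt (by linarith)) hθ hηN t ⟨t.cast_nonneg, htN⟩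
    have : η * (2 * B) * t ≤ η * (2 * B) * N := by
      have := hB.pos
      gcongr
    linarith [norm_le_norm_add_norm_sub' (γ t) θ]
  have one_step : ∀ t < N, dist (update U η (γ t)) (γ (t + 1 : ℕ)) ≤ 9 * B ^ 3 * η ^ 3 := by
    intro t ht
    have htN : (t : ℝ) + 1 ≤ N := by exact_mod_cast ht
    simpa [dist_eq_norm, norm_sub_rev] using
      (h.shift t.cast_nonneg htN).norm_apply_one_sub_le hB (ball t ht.le)
  simpa [h.1, dist_eq_norm] using
    dist_iterate_le (lipschitzWith_update hLip hη1) (y := fun t : ℕ => γ t) one_step ht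

lemma locO_gradient_leading (hU : ContDiff ℝ 2 U) (hsym : SymmetricJacobian U) :
    LocO 1 fun η θ => gradient (leading U η) θ :=
  (locO_mul_smul_of_continuous (contDiff_selfForce hU).continuous 2⁻¹).congr fun η _ θ => by
    rw [gradient_leading (hU.differentiable two_ne_zero) hsym, div_eq_inv_mul]

lemma locO_fderiv_gradient_leading (hU : ContDiff ℝ 2 U) (hsym : SymmetricJacobian U) :
    LocO 1 fun η θ => fderiv ℝ (gradient (leading U η)) θ :=
  (locO_mul_smul_of_continuous ((contDiff_selfForce hU).continuous_fderiv one_ne_zero) 2⁻¹).congr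
    fun η _ θ => by
      rw [gradient_leading (hU.differentiable two_ne_zero) hsym,
        fderiv_fun_const_smul ((contDiff_selfForce hU).differentiable one_ne_zero θ),
        div_eq_inv_mul]

lemma isDEPotential_leading (hU : ContDiff ℝ 2 U) {Λ : NNReal} (hLip : LipschitzWith Λ U)
    (hsym : SymmetricJacobian U) : IsDEPotential U (leading U) where
  smooth η _ := contDiff_leading hU η
  force_small := locO_gradient_leading hU hsym
  deriv_small := locO_fderiv_gradient_leading hU hsym
  matching N := forall_isCompact_iff_forall_norm_le.2 fun R => by
    obtain ⟨B, hB⟩ := exists_eventually_correctionBounds_of_locO hU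
      (fun η _ => differentiable_gradient (contDiff_leading hU η)) (locO_gradient_leading hU hsym)
      (locO_fderiv_gradient_leading hU hsym) (R + 1 + 1)
    refine ⟨(∑ i ∈ Finset.range N, (1 + Λ : ℝ) ^ i) * (9 * B ^ 3), ?_⟩
    filter_upwards [hB, eventually_mul_le one_pos (2 * B * N)] with η hη hηN θ hθ
    rw [← mul_assoc] at hηN
    rw [gradient_leading (hU.differentiable two_ne_zero) hsym] at hη ⊢
    have hV : ContDiff ℝ 1 fun x => U x + (η / 2) • selfForce U x :=
      (hU.of_le one_le_two).add ((contDiff_selfForce hU).const_smul _)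
    obtain ⟨γ, hγ⟩ := exists_isFlowLine hV hη.step_pos N.cast_nonneg
      (fun x hx => (hη.norm_add_lt (by linarith)).le) hηN hθ
    refine ⟨γ, hγ, fun t ht => ?_⟩
    have hB0 := hη.pos
    have hη0 := hη.step_pos
    calc ‖(update U η)^[t] θ - γ t‖
        ≤ (∑ i ∈ Finset.range t, (1 + Λ : ℝ) ^ i) * (9 * B ^ 3 * η ^ 3) :=
          hγ.norm_iterate_sub_le hLip hη hηN hθ ht
      _ ≤ (∑ i ∈ Finset.range N, (1 + Λ : ℝ) ^ i) * (9 * B ^ 3 * η ^ 3) := by gcongr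
      _ = (∑ i ∈ Finset.range N, (1 + Λ : ℝ) ^ i) * (9 * B ^ 3) * η ^ 3 := by ring

end DiscretizationError

/-! ### Time renormalization -/

section TimeRenormalization

lemma update_update_sub_update (W V : Param d → Param d) (h : ℝ) (θ : Param d) :
    update W h (update W h θ) - update V (2 * h) θ
      = -(h • (W θ + W (update W h θ) - (2 : ℝ) • V θ)) := by
  simp only [update]
  module

lemma norm_update_apply_sub_add_selfForce_le {W : Param d → Param d} {R B η h : ℝ} {θ : Param d}
    (hB : CorrectionBounds U (fun x => W x - U x) (R + 1) B η) (h0 : 0 < h) (hη : h ≤ η)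
    (hθ : ‖θ‖ ≤ R) :
    ‖W (update W h θ) - W θ + h • selfForce U θ‖ ≤ 7 * B ^ 3 * (h * η) := by
  have hθ' : ‖θ‖ ≤ R + 1 := by linarith
  have hB1 := hB.one_le
  have hη0 := hB.step_pos
  have hdiff : update W h θ - θ = -(h • W θ) := by simp only [update]; abel
  have near : ‖update W h θ - θ‖ ≤ 2 * B * h := by
    have hW : ‖W θ‖ ≤ 2 * B := by simpa using (hB.norm_add_lt hθ').le
    rw [hdiff, norm_neg, norm_smul, Real.norm_of_nonneg h0.le, mul_comm]
    gcongr
  have ball : ‖update W h θ‖ ≤ R + 1 := by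
    have := norm_le_norm_add_norm_sub' (update W h θ) θ
    nlinarith [hB.step_small]
  have linear : ‖update W h θ - θ + h • U θ‖ ≤ h * (B * η) := by
    rw [hdiff, ← norm_neg, neg_add, neg_neg, ← sub_eq_add_neg, ← smul_sub, norm_smul,
      Real.norm_of_nonneg h0.le]
    gcongr
    exact hB.norm_correction_le θ hθ'
  have hpow : B ^ 2 ≤ B ^ 3 := pow_le_pow_right₀ hB1 (by norm_num)
  calc ‖W (update W h θ) - W θ + h • selfForce U θ‖
      ≤ 6 * B ^ 3 * (h * η) + B * (h * (B * η)) := by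
        simpa using hB.norm_sub_add_selfForce_le hη hθ' ball near linear
    _ = 6 * B ^ 3 * (h * η) + B ^ 2 * (h * η) := by ring
    _ ≤ 6 * B ^ 3 * (h * η) + B ^ 3 * (h * η) := by gcongr
    _ = 7 * B ^ 3 * (h * η) := by ring

lemma norm_sub_sub_smul_selfForce_le {V W : Param d → Param d} {R B C η h : ℝ} {θ : Param d}
    (hB : CorrectionBounds U (fun x => W x - U x) (R + 1) B η) (h0 : 0 < h) (hη : h ≤ η)
    (hθ : ‖θ‖ ≤ R)
    (hstep : ‖update W h (update W h θ) - update V (2 * h) θ‖ ≤ C * h ^ 3) :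
    ‖W θ - V θ - (h / 2) • selfForce U θ‖ ≤ (7 * B ^ 3 + C) / 2 * (h * η) := by
  have hη0 := hB.step_pos
  have hC : 0 ≤ C := nonneg_of_mul_nonneg_left ((norm_nonneg _).trans hstep) (by positivity)
  have field : ‖W (update W h θ) - W θ + h • selfForce U θ‖ ≤ 7 * B ^ 3 * (h * η) :=
    norm_update_apply_sub_add_selfForce_le hB h0 hη hθ
  have sum : ‖W θ + W (update W h θ) - (2 : ℝ) • V θ‖ ≤ C * (h * η) := by
    rw [update_update_sub_update, norm_neg, norm_smul, Real.norm_of_nonneg h0.le] at hstep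
    refine le_of_mul_le_mul_left (hstep.trans ?_) h0
    calc C * h ^ 3 = h * (C * (h * h)) := by ring
      _ ≤ h * (C * (h * η)) := by gcongr
  calc ‖W θ - V θ - (h / 2) • selfForce U θ‖
      = ‖(2⁻¹ : ℝ) • ((W θ + W (update W h θ) - (2 : ℝ) • V θ)
          - (W (update W h θ) - W θ + h • selfForce U θ))‖ := by congr 1; module
    _ = 2⁻¹ * ‖(W θ + W (update W h θ) - (2 : ℝ) • V θ)
          - (W (update W h θ) - W θ + h • selfForce U θ)‖ := by rw [norm_smul]; norm_num
    _ ≤ 2⁻¹ * (C * (h * η) + 7 * B ^ 3 * (h * η)) := by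
        gcongr
        exact norm_sub_le_of_le sum field
    _ = (7 * B ^ 3 + C) / 2 * (h * η) := by ring

lemma IsRefinement.norm_succ_sub_le (hU : ContDiff ℝ 2 U) {V : ℝ → ℕ → Param d → Param d}
    (hV : IsRefinement U V) (R : ℝ) :
    ∃ D, ∀ᶠ η in 𝓝[>] (0 : ℝ), ∀ θ, ‖θ‖ ≤ R → ∀ k,
      ‖V η (k + 1) θ - V η k θ - (η / 2 ^ (k + 1) / 2) • selfForce U θ‖
        ≤ D * η ^ 2 / 2 / 2 ^ k := by
  have hUd := hU.differentiable two_ne_zero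
  obtain ⟨C₁, hsmall⟩ := (forall_isCompact_iff_forall_norm_le
    (p := fun C η θ => ∀ k,
      ‖V η k θ - U θ‖ ≤ C * η ∧ ‖fderiv ℝ (V η k) θ - fderiv ℝ U θ‖ ≤ C * η)).1
    (by simpa only [@forall_comm ℕ] using hV.small) (R + 1)
  obtain ⟨C₂, hconsistent⟩ := (forall_isCompact_iff_forall_norm_le
    (p := fun C η θ => ∀ k, ‖update (V η (k + 1)) (η / 2 ^ (k + 1))
      (update (V η (k + 1)) (η / 2 ^ (k + 1)) θ) - update (V η k) (η / 2 ^ k) θ‖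
        ≤ C * (η / 2 ^ k) ^ 3)).1
    (by simpa only [@forall_comm ℕ] using hV.consistent) R
  obtain ⟨B, hB⟩ := exists_eventually_correctionBounds hU (R + 1) C₁
  refine ⟨(7 * B ^ 3 + 8 * C₂) / 2, ?_⟩
  filter_upwards [self_mem_nhdsWithin, hsmall, hconsistent, hB]
    with η (hη : 0 < η) hsmall hconsistent hB θ hθ k
  have hVd := hV.smooth η hη (k + 1)
  have hbounds : CorrectionBounds U (fun x => V η (k + 1) x - U x) (R + 1) B η :=
    hB _ (hVd.sub hUd) fun x hx => by
      rw [fderiv_fun_sub (hVd x) (hUd x)]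
      exact hsmall x hx (k + 1)
  have hhalf : η / 2 ^ k = 2 * (η / 2 ^ (k + 1)) := by rw [pow_succ]; field_simp
  have hstep := hconsistent θ hθ k
  rw [hhalf, mul_pow, ← mul_assoc] at hstep
  refine (norm_sub_sub_smul_selfForce_le hbounds (by positivity)
    (div_le_self hη.le (one_le_pow₀ one_le_two)) hθ hstep).trans_eq ?_
  rw [pow_succ]
  field_simp
  ring

lemma IsRefinement.exists_limit (hU : ContDiff ℝ 2 U) {V : ℝ → ℕ → Param d → Param d}
    (hV : IsRefinement U V) (R : ℝ) :
    ∃ D, ∀ᶠ η in 𝓝[>] (0 : ℝ), ∀ θ, ‖θ‖ ≤ R → ∃ W : Param d,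
      Tendsto (fun k => V η k θ) atTop (𝓝 W) ∧
      ‖W - (U θ + (η / 2) • selfForce U θ)‖ ≤ D * η ^ 2 := by
  obtain ⟨D, hD⟩ := hV.norm_succ_sub_le hU R
  refine ⟨D, ?_⟩
  filter_upwards [self_mem_nhdsWithin, hD] with η (hη : 0 < η) hstep θ hθ
  -- Partial sums of `∑ η / 2 ^ (k + 1) / 2 = η / 2`; once they are removed, the steps are `O(η²)`.
  set g : ℕ → Param d := fun k => (η / 2 * (1 - (1 / 2) ^ k)) • selfForce U θ with hg
  have hdist : ∀ k, dist (V η k θ - g k) (V η (k + 1) θ - g (k + 1)) ≤ D * η ^ 2 / 2 / 2 ^ k := by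
    intro k
    have hsum : η / 2 * (1 - (1 / 2) ^ (k + 1))
        = η / 2 * (1 - (1 / 2) ^ k) + η / 2 ^ (k + 1) / 2 := by
      rw [one_div_pow, one_div_pow, pow_succ]; field_simp; ring
    rw [dist_comm, dist_eq_norm]
    refine (congrArg norm ?_).trans_le (hstep θ hθ k)
    simp only [hg, hsum]
    module
  have hglim : Tendsto g atTop (𝓝 ((η / 2) • selfForce U θ)) := by
    have hpow := tendsto_pow_atTop_nhds_zero_of_lt_one (r := (1 / 2 : ℝ)) (by norm_num)
      (by norm_num)
    simpa [hg] using ((hpow.const_sub 1).const_mul (η / 2)).smul_const (selfForce U θ)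
  obtain ⟨a, ha⟩ := cauchySeq_tendsto_of_complete (cauchySeq_of_le_geometric_two hdist)
  refine ⟨a + (η / 2) • selfForce U θ, by simpa using ha.add hglim, ?_⟩
  have hlim := dist_le_of_le_geometric_two_of_tendsto₀ hdist ha
  rw [dist_comm, dist_eq_norm] at hlim
  simpa [hg, hV.zero η hη] using hlim

lemma IsRefinement.isTRPotential_leading (hU : ContDiff ℝ 2 U) (hsym : SymmetricJacobian U)
    {V : ℝ → ℕ → Param d → Param d} (hV : IsRefinement U V) : IsTRPotential U V (leading U) where
  smooth η _ := (contDiff_leading hU η).differentiable two_ne_zero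
  limit := forall_isCompact_iff_forall_norm_le.2 fun R => by
    simpa only [gradient_leading (hU.differentiable two_ne_zero) hsym] using hV.exists_limit hU R

lemma IsTRPotential.eqLeadingUpToConst (hU : ContDiff ℝ 2 U) (hsym : SymmetricJacobian U)
    {V : ℝ → ℕ → Param d → Param d} (hV : IsRefinement U V) {φ : ℝ → Param d → ℝ}
    (h : IsTRPotential U V φ) : EqLeadingUpToConst U φ := by
  refine eqLeadingUpToConst_of_gradient (hU.differentiable two_ne_zero) hsym h.smooth
    (locO_iff.2 fun R => ?_)
  obtain ⟨D, hD⟩ := hV.exists_limit hU R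
  obtain ⟨C, hC⟩ := forall_isCompact_iff_forall_norm_le.1 h.limit R
  refine ⟨D + C, ?_⟩
  filter_upwards [hD, hC] with η hη hη' θ hθ
  obtain ⟨W, hW, hleading⟩ := hη θ hθ
  obtain ⟨W', hW', hφ⟩ := hη' θ hθ
  obtain rfl := tendsto_nhds_unique hW hW'
  calc ‖gradient (φ η) θ - (η / 2) • selfForce U θ‖
      = ‖(W - (U θ + (η / 2) • selfForce U θ)) - (W - (U θ + gradient (φ η) θ))‖ := by
        congr 1; abel
    _ ≤ D * η ^ 2 + C * η ^ 2 := norm_sub_le_of_le hleading hφ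
    _ = (D + C) * η ^ 2 := by ring

end TimeRenormalization

/-! ### Transport of a field along itself -/

section Transport

variable {E : Type*} [NormedAddCommGroup E] [NormedSpace ℝ E] {U V W : E → E} {Λ : NNReal}
  {c : ℝ} {R B : ℝ}

/-- The solution `W` of the implicit equation `W(θ) = U(θ + c W(θ))`, that is, the field `U`
transported along itself for the time `c`. It is determined when `U` is Lipschitz and `c` is small
against the Lipschitz constant. -/
def transport (U : E → E) (c : ℝ) (θ : E) : E :=
  Classical.epsilon fun w => U (θ + c • w) = w

lemma norm_sub_le_of_apply_add_smul_eq (hLip : LipschitzWith Λ U) {θ θ' w w' : E}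
    (hw : U (θ + c • w) = w) (hw' : U (θ' + c • w') = w') :
    (1 - |c| * Λ) * ‖w' - w‖ ≤ Λ * ‖θ' - θ‖ := by
  have h : ‖w' - w‖ ≤ Λ * (‖θ' - θ‖ + |c| * ‖w' - w‖) :=
    calc ‖w' - w‖ = ‖U (θ' + c • w') - U (θ + c • w)‖ := by rw [hw, hw']
      _ ≤ Λ * ‖(θ' + c • w') - (θ + c • w)‖ := hLip.norm_sub_le _ _
      _ = Λ * ‖(θ' - θ) + c • (w' - w)‖ := by congr 2; module
      _ ≤ Λ * (‖θ' - θ‖ + |c| * ‖w' - w‖) := by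
          gcongr
          exact (norm_add_le _ _).trans_eq (by rw [norm_smul, Real.norm_eq_abs])
  linarith

section

variable [CompleteSpace E] (hLip : LipschitzWith Λ U) (hc : |c| * Λ < 1)
include hLip hc

lemma apply_add_smul_transport (θ : E) : U (θ + c • transport U c θ) = transport U c θ := by
  have hcontr : ContractingWith (Λ * (1 * ‖c‖₊)) fun w => U (θ + c • w) := by
    refine ⟨?_, hLip.comp ((isometry_add_left θ).lipschitz.comp (lipschitzWith_smul c))⟩
    rw [one_mul, mul_comm, ← NNReal.coe_lt_coe]
    simpa using hc
  exact Classical.epsilon_spec ⟨_, hcontr.fixedPoint_isFixedPt⟩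

lemma eq_transport {θ w : E} (hw : U (θ + c • w) = w) : w = transport U c θ := by
  have h := norm_sub_le_of_apply_add_smul_eq hLip (apply_add_smul_transport hLip hc θ) hw
  rw [sub_self, norm_zero, mul_zero] at h
  exact sub_eq_zero.1 (norm_le_zero_iff.1 (nonpos_of_mul_nonpos_right h (sub_pos.2 hc)))

lemma transport_add {c' : ℝ} (hc' : |c + c'| * Λ < 1) (θ : E) :
    transport U c (θ + c' • transport U (c + c') θ) = transport U (c + c') θ := by
  refine (eq_transport hLip hc ?_).symm
  rw [add_assoc, ← add_smul, add_comm c' c]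
  exact apply_add_smul_transport hLip hc' θ

lemma continuous_transport : Continuous (transport U c) := by
  refine (LipschitzWith.of_dist_le_mul (K := Real.toNNReal ((1 - |c| * Λ)⁻¹ * Λ))
    fun θ' θ => ?_).continuous
  have hpos := sub_pos.2 hc
  rw [Real.coe_toNNReal _ (by positivity), dist_eq_norm, dist_eq_norm, mul_assoc,
    le_inv_mul_iff₀ hpos]
  exact norm_sub_le_of_apply_add_smul_eq hLip (apply_add_smul_transport hLip hc θ)
    (apply_add_smul_transport hLip hc θ')

lemma differentiable_transport (hU : Differentiable ℝ U) : Differentiable ℝ (transport U c) := by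
  have hfix := apply_add_smul_transport hLip hc
  -- `θ ↦ θ + c W(θ)` is a continuous inverse of `x ↦ x - c U(x)`, whose derivative is invertible.
  suffices h : Differentiable ℝ fun θ => θ + c • transport U c θ by
    have := hU.comp h
    simpa only [Function.comp_def, hfix] using this
  intro θ
  set x := θ + c • transport U c θ
  have hsmall : ‖c • fderiv ℝ U x‖ < 1 := by
    rw [norm_smul, Real.norm_eq_abs]
    exact (mul_le_mul_of_nonneg_left (norm_fderiv_le_of_lipschitz ℝ hLip)
      (abs_nonneg c)).trans_lt hc
  have hderiv : HasFDerivAt (fun x => x - c • U x)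
      (ContinuousLinearEquiv.ofUnit (Units.oneSub _ hsmall) : E →L[ℝ] E) x :=
    (hasFDerivAt_id (𝕜 := ℝ) x).sub ((hU x).hasFDerivAt.const_smul c)
  refine (hderiv.of_local_left_inverse
    (continuous_id.add ((continuous_transport hLip hc).const_smul c)).continuousAt
    (Eventually.of_forall fun θ => ?_)).differentiableAt
  simp [hfix]

lemma fderiv_transport (hU : Differentiable ℝ U) (θ : E) :
    fderiv ℝ (transport U c) θ = (fderiv ℝ U (θ + c • transport U c θ)).comp
      (ContinuousLinearMap.id ℝ E + c • fderiv ℝ (transport U c) θ) := by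
  have h := (hU (θ + c • transport U c θ)).hasFDerivAt.comp θ ((hasFDerivAt_id θ).add
    ((differentiable_transport hLip hc hU θ).hasFDerivAt.const_smul c))
  have hfix : U ∘ (id + c • transport U c) = transport U c :=
    funext (apply_add_smul_transport hLip hc)
  exact (hfix ▸ h).fderiv

end

lemma transport_zero (U : E → E) : transport U 0 = U := by
  funext θ
  have h := Classical.epsilon_spec (p := fun w => U (θ + (0 : ℝ) • w) = w) ⟨U θ, by simp⟩
  simpa [transport] using h.symm

section

variable [CompleteSpace E] (hLip : LipschitzWith Λ U) (hcΛ : |c| * Λ ≤ 1 / 2)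
include hLip hcΛ

lemma norm_transport_le (θ : E) : ‖transport U c θ‖ ≤ 2 * ‖U θ‖ := by
  have hsub : ‖transport U c θ - U θ‖ ≤ Λ * (|c| * ‖transport U c θ‖) :=
    calc ‖transport U c θ - U θ‖
        = ‖U (θ + c • transport U c θ) - U θ‖ := by
          rw [apply_add_smul_transport hLip (by linarith)]
      _ ≤ Λ * ‖θ + c • transport U c θ - θ‖ := hLip.norm_sub_le _ _
      _ = Λ * (|c| * ‖transport U c θ‖) := by
          rw [add_sub_cancel_left, norm_smul, Real.norm_eq_abs]
  have htri := norm_le_norm_add_norm_sub' (transport U c θ) (U θ)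
  nlinarith [norm_nonneg (transport U c θ)]

variable (hB : LocalBounds U (R + 1) B) (hcB : |c| * (2 * B) ≤ 1) {θ θ' : E}
include hB

lemma norm_smul_transport_le (hθ : ‖θ‖ ≤ R) : ‖c • transport U c θ‖ ≤ |c| * (2 * B) := by
  rw [norm_smul, Real.norm_eq_abs]
  have := norm_transport_le hLip hcΛ θ
  have := hB.norm_le θ (by linarith)
  gcongr
  linarith

include hcB

lemma norm_add_smul_transport_le (hθ : ‖θ‖ ≤ R) : ‖θ + c • transport U c θ‖ ≤ R + 1 :=
  norm_add_le_of_le hθ ((norm_smul_transport_le hLip hcΛ hB hθ).trans hcB)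

lemma norm_fderiv_transport_le (hθ : ‖θ‖ ≤ R) : ‖fderiv ℝ (transport U c) θ‖ ≤ 2 * B := by
  have hJ := hB.norm_fderiv_le _ (norm_add_smul_transport_le hLip hcΛ hB hcB hθ)
  have h : ‖fderiv ℝ (transport U c) θ‖ ≤ B * (1 + |c| * ‖fderiv ℝ (transport U c) θ‖) := by
    conv_lhs => rw [fderiv_transport hLip (by linarith) hB.differentiable]
    refine (ContinuousLinearMap.opNorm_comp_le _ _).trans (mul_le_mul hJ ?_ (norm_nonneg _)
      hB.pos.le)
    refine norm_add_le_of_le ContinuousLinearMap.norm_id_le ?_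
    rw [norm_smul, Real.norm_eq_abs]
  nlinarith [norm_nonneg (fderiv ℝ (transport U c) θ)]

lemma norm_transport_sub_le (hθ : ‖θ‖ ≤ R) : ‖transport U c θ - U θ‖ ≤ 2 * B ^ 2 * |c| :=
  calc ‖transport U c θ - U θ‖ = ‖U (θ + c • transport U c θ) - U θ‖ := by
        rw [apply_add_smul_transport hLip (by linarith)]
    _ ≤ B * ‖θ + c • transport U c θ - θ‖ :=
        hB.norm_sub_le (by linarith) (norm_add_smul_transport_le hLip hcΛ hB hcB hθ)
    _ ≤ B * (|c| * (2 * B)) := by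
        rw [add_sub_cancel_left]
        exact mul_le_mul_of_nonneg_left (norm_smul_transport_le hLip hcΛ hB hθ) hB.pos.le
    _ = 2 * B ^ 2 * |c| := by ring

lemma norm_fderiv_transport_sub_fderiv_le (hθ : ‖θ‖ ≤ R) :
    ‖fderiv ℝ (transport U c) θ - fderiv ℝ U θ‖ ≤ 4 * B ^ 2 * |c| := by
  have hx := norm_add_smul_transport_le hLip hcΛ hB hcB hθ
  have hsub := hB.norm_fderiv_sub_le θ _ (by linarith) hx
  rw [add_sub_cancel_left] at hsub
  have hcomp := (ContinuousLinearMap.opNorm_comp_le (fderiv ℝ U (θ + c • transport U c θ))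
    (fderiv ℝ (transport U c) θ)).trans (mul_le_mul (hB.norm_fderiv_le _ hx)
      (norm_fderiv_transport_le hLip hcΛ hB hcB hθ) (norm_nonneg _) hB.pos.le)
  calc ‖fderiv ℝ (transport U c) θ - fderiv ℝ U θ‖
      = ‖(fderiv ℝ U (θ + c • transport U c θ) - fderiv ℝ U θ)
          + c • (fderiv ℝ U (θ + c • transport U c θ)).comp (fderiv ℝ (transport U c) θ)‖ := by
        conv_lhs => rw [fderiv_transport hLip (by linarith) hB.differentiable]
        simp only [ContinuousLinearMap.comp_add, ContinuousLinearMap.comp_smul,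
          ContinuousLinearMap.comp_id, add_sub_right_comm]
    _ ≤ B * (|c| * (2 * B)) + |c| * (B * (2 * B)) := by
        refine norm_add_le_of_le (hsub.trans (mul_le_mul_of_nonneg_left
          (norm_smul_transport_le hLip hcΛ hB hθ) hB.pos.le)) ?_
        rw [norm_smul, Real.norm_eq_abs]
        gcongr
    _ = 4 * B ^ 2 * |c| := by ring

lemma norm_add_smul_transport_sub_le (hθ : ‖θ‖ ≤ R) (hθ' : ‖θ'‖ ≤ R) :
    ‖(θ' + c • transport U c θ') - (θ + c • transport U c θ)‖ ≤ 2 * ‖θ' - θ‖ := by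
  have hW := norm_image_sub_le_of_norm_fderiv_le_of_norm_le
    (differentiable_transport hLip (by linarith) hB.differentiable)
    (fun _ => norm_fderiv_transport_le hLip hcΛ hB hcB) hθ hθ'
  calc ‖(θ' + c • transport U c θ') - (θ + c • transport U c θ)‖
      = ‖(θ' - θ) + c • (transport U c θ' - transport U c θ)‖ := by congr 1; module
    _ ≤ ‖θ' - θ‖ + |c| * (2 * B * ‖θ' - θ‖) := by
        refine norm_add_le_of_le le_rfl ?_
        rw [norm_smul, Real.norm_eq_abs]
        gcongr
    _ ≤ 2 * ‖θ' - θ‖ := by nlinarith [norm_nonneg (θ' - θ)]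

lemma norm_fderiv_transport_sub_le (hθ : ‖θ‖ ≤ R) (hθ' : ‖θ'‖ ≤ R) :
    ‖fderiv ℝ (transport U c) θ' - fderiv ℝ (transport U c) θ‖ ≤ 8 * B * ‖θ' - θ‖ := by
  have hc : |c| * Λ < 1 := by linarith
  have hB0 := hB.pos
  have hx := norm_add_smul_transport_le hLip hcΛ hB hcB hθ
  have hx' := norm_add_smul_transport_le hLip hcΛ hB hcB hθ'
  set x := θ + c • transport U c θ
  set x' := θ' + c • transport U c θ'
  set D := fderiv ℝ (transport U c) θ with hD
  set D' := fderiv ℝ (transport U c) θ' with hD'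
  have hdist : ‖x' - x‖ ≤ 2 * ‖θ' - θ‖ :=
    norm_add_smul_transport_sub_le hLip hcΛ hB hcB hθ hθ'
  have hfactor : ‖ContinuousLinearMap.id ℝ E + c • D'‖ ≤ 2 := by
    refine (norm_add_le_of_le ContinuousLinearMap.norm_id_le (?_ : _ ≤ (1 : ℝ))).trans_eq
      one_add_one_eq_two
    rw [norm_smul, Real.norm_eq_abs]
    exact (mul_le_mul_of_nonneg_left (norm_fderiv_transport_le hLip hcΛ hB hcB hθ')
      (abs_nonneg c)).trans hcB
  have h : ‖D' - D‖ ≤ B * (2 * ‖θ' - θ‖) * 2 + |c| * (B * ‖D' - D‖) :=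
    calc ‖D' - D‖
        = ‖(fderiv ℝ U x' - fderiv ℝ U x).comp (ContinuousLinearMap.id ℝ E + c • D')
            + c • (fderiv ℝ U x).comp (D' - D)‖ := by
          conv_lhs => rw [hD, hD', fderiv_transport hLip hc hB.differentiable θ,
            fderiv_transport hLip hc hB.differentiable θ']
          congr 1
          simp only [ContinuousLinearMap.comp_add, ContinuousLinearMap.sub_comp,
            ContinuousLinearMap.comp_sub, ContinuousLinearMap.comp_smul, smul_sub]
          abel
      _ ≤ B * (2 * ‖θ' - θ‖) * 2 + |c| * (B * ‖D' - D‖) := by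
          refine norm_add_le_of_le ((ContinuousLinearMap.opNorm_comp_le _ _).trans ?_) ?_
          · have := (hB.norm_fderiv_sub_le x x' hx hx').trans
              (mul_le_mul_of_nonneg_left hdist hB0.le)
            gcongr
          · rw [norm_smul, Real.norm_eq_abs]
            gcongr
            exact (ContinuousLinearMap.opNorm_comp_le _ _).trans
              (mul_le_mul_of_nonneg_right (hB.norm_fderiv_le x hx) (norm_nonneg _))
  nlinarith [norm_nonneg (D' - D)]

lemma localBounds_transport : LocalBounds (transport U c) R (8 * B) where
  one_le := by linarith [hB.one_le]
  differentiable := differentiable_transport hLip (by linarith) hB.differentiable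
  norm_le θ hθ := by
    linarith [norm_transport_le hLip hcΛ θ, hB.norm_le θ (by linarith), hB.pos]
  norm_fderiv_le θ hθ := by
    linarith [norm_fderiv_transport_le hLip hcΛ hB hcB hθ, hB.pos]
  norm_fderiv_sub_le _ _ := norm_fderiv_transport_sub_le hLip hcΛ hB hcB

end

/-- The midpoint rule: with `V(x + h W(x) / 2) = W(x)`, the values of `W` at the two ends of a step
are values of `V` at points which are symmetric about `θ` up to `O(h²)`. -/
lemma norm_add_sub_two_smul_le {h : ℝ} {θ : E} (hV : LocalBounds V (R + 1) B)
    (hW : LocalBounds W (R + 1) B) (hVW : ∀ x, V (x + (h / 2) • W x) = W x) (h0 : 0 ≤ h)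
    (hh : h * (2 * B) ≤ 1) (hθ : ‖θ‖ ≤ R) :
    ‖W θ + W (θ - h • W θ) - (2 : ℝ) • V θ‖ ≤ B ^ 3 * h ^ 2 := by
  have hθ' : ‖θ‖ ≤ R + 1 := by linarith
  have hB := hW.pos
  set v := (h / 2) • W θ with hv
  set x := θ - h • W θ with hx
  have norm_half_smul : ∀ y, ‖y‖ ≤ R + 1 → ‖(h / 2) • W y‖ ≤ h / 2 * B := fun y hy => by
    rw [norm_smul, Real.norm_of_nonneg (by positivity)]
    gcongr
    exact hW.norm_le y hy
  have hvB : ‖v‖ ≤ h / 2 * B := norm_half_smul θ hθ'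
  have hxv : x = θ - v - v := by rw [hx, hv]; module
  have hsub : ‖θ - v‖ ≤ R + h / 2 * B := norm_sub_le_of_le hθ hvB
  have hxR : ‖x‖ ≤ R + h / 2 * B + h / 2 * B := hxv ▸ norm_sub_le_of_le hsub hvB
  have hx1 : ‖x‖ ≤ R + 1 := by linarith
  have hend : ‖x + (h / 2) • W x‖ ≤ R + 1 :=
    (norm_add_le_of_le hxR (norm_half_smul x hx1)).trans (by linarith)
  have hsecond := hV.norm_second_difference_le hθ' ((norm_add_le_of_le hθ hvB).trans (by linarith))
    (hsub.trans (by linarith))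
  have hshift := hV.norm_sub_le (x := θ - v) (hsub.trans (by linarith)) hend
  have hshift' : ‖x + (h / 2) • W x - (θ - v)‖ ≤ h / 2 * (B * (2 * (h / 2 * B))) :=
    calc ‖x + (h / 2) • W x - (θ - v)‖ = ‖(h / 2) • (W x - W θ)‖ := by
          rw [hxv, smul_sub, ← hv]; congr 1; abel
      _ = h / 2 * ‖W x - W θ‖ := by rw [norm_smul, Real.norm_of_nonneg (by positivity)]
      _ ≤ h / 2 * (B * ‖x - θ‖) := by gcongr; exact hW.norm_sub_le hθ' hx1
      _ = h / 2 * (B * (2 * ‖v‖)) := by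
          rw [show x - θ = -(2 : ℝ) • v by rw [hxv]; module, norm_smul]; norm_num
      _ ≤ h / 2 * (B * (2 * (h / 2 * B))) := by gcongr
  calc ‖W θ + W x - (2 : ℝ) • V θ‖
      = ‖(V (θ + v) + V (θ - v) - (2 : ℝ) • V θ) + (V (x + (h / 2) • W x) - V (θ - v))‖ := by
        rw [hVW x, hv, hVW θ]; congr 1; abel
    _ ≤ 2 * B * (h / 2 * B) ^ 2 + B * (h / 2 * (B * (2 * (h / 2 * B)))) :=
        norm_add_le_of_le (hsecond.trans (by gcongr)) (hshift.trans (by gcongr))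
    _ = B ^ 3 * h ^ 2 := by ring

end Transport

section Refinement

lemma isSymmetric_of_eq_comp_id_add_smul {E : Type*} [NormedAddCommGroup E]
    [InnerProductSpace ℝ E] {J D : E →ₗ[ℝ] E} {c : ℝ} (hJ : J.IsSymmetric)
    (hD : ∀ v, D v = J (v + c • D v)) : D.IsSymmetric := by
  have key : ∀ a b, inner ℝ (D a) b = inner ℝ (J (a + c • D a)) (b + c • D b)
      - c * inner ℝ (D a) (D b) := fun a b => by
    rw [← hD, inner_add_right, real_inner_smul_right]
    ring
  intro a b
  rw [key, hJ, real_inner_comm (D b) a, key b a, real_inner_comm _ (J _), real_inner_comm (D a)]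

lemma symmetricJacobian_transport {Λ : NNReal} {c : ℝ} (hU : Differentiable ℝ U)
    (hLip : LipschitzWith Λ U) (hsym : SymmetricJacobian U) (hc : |c| * Λ < 1) :
    SymmetricJacobian (transport U c) := fun θ =>
  isSymmetric_of_eq_comp_id_add_smul (hsym (θ + c • transport U c θ)) fun v => by
    conv_lhs => rw [fderiv_transport hLip hc hU]
    rfl

/-- The transport time of the `k`-th refined field: it increases from `0` to `η / 2`, by half the
step size `η / 2 ^ (k + 1)` at a time. Large `η` are cut off, so that `transport` is determined. -/
def refinementTime (Λ : NNReal) (η : ℝ) (k : ℕ) : ℝ :=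
  min η (1 + Λ : ℝ)⁻¹ / 2 * (1 - (1 / 2) ^ k)

lemma abs_refinementTime_le {Λ : NNReal} {η : ℝ} (hη : 0 < η) (k : ℕ) :
    |refinementTime Λ η k| ≤ min η (1 + Λ : ℝ)⁻¹ / 2 := by
  have hpow : ((1 : ℝ) / 2) ^ k ≤ 1 := pow_le_one₀ (by norm_num) (by norm_num)
  have hmin : 0 < min η (1 + Λ : ℝ)⁻¹ / 2 := by positivity
  rw [refinementTime, abs_of_nonneg (mul_nonneg hmin.le (sub_nonneg.2 hpow))]
  exact mul_le_of_le_one_right hmin.le (by linarith [pow_pos (one_half_pos (α := ℝ)) k])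

lemma abs_refinementTime_mul_le {Λ : NNReal} {η : ℝ} (hη : 0 < η) (k : ℕ) :
    |refinementTime Λ η k| * Λ ≤ 1 / 2 :=
  calc |refinementTime Λ η k| * Λ ≤ (1 + Λ : ℝ)⁻¹ / 2 * (1 + Λ) := by
        have := abs_refinementTime_le (Λ := Λ) hη k
        gcongr
        · exact this.trans (by gcongr; exact min_le_right _ _)
        · simp
    _ = 1 / 2 := by field_simp

lemma refinementTime_succ {Λ : NNReal} {η : ℝ} (hη : η ≤ (1 + Λ : ℝ)⁻¹) (k : ℕ) :
    refinementTime Λ η (k + 1) = refinementTime Λ η k + η / 2 ^ (k + 1) / 2 := by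
  rw [refinementTime, refinementTime, min_eq_left hη, one_div_pow, one_div_pow, pow_succ]
  field_simp
  ring

lemma eventually_abs_refinementTime_mul_le (Λ : NNReal) (B : ℝ) :
    ∀ᶠ η in 𝓝[>] (0 : ℝ), ∀ k, |refinementTime Λ η k| * (2 * B) ≤ 1 := by
  filter_upwards [self_mem_nhdsWithin, eventually_mul_le one_pos |B|] with η (hη : 0 < η) hB k
  have habs := (abs_refinementTime_le (Λ := Λ) hη k).trans
    (div_le_div_of_nonneg_right (min_le_left _ _) zero_le_two)
  calc |refinementTime Λ η k| * (2 * B) ≤ |refinementTime Λ η k| * (2 * |B|) := by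
        gcongr; exact le_abs_self B
    _ ≤ η / 2 * (2 * |B|) := by gcongr
    _ = η * |B| := by ring
    _ ≤ 1 := hB

variable {Λ : NNReal} (hU : ContDiff ℝ 2 U) (hLip : LipschitzWith Λ U)
include hU hLip

lemma exists_eventually_transport_sub_le (R : ℝ) :
    ∃ C, ∀ᶠ η in 𝓝[>] (0 : ℝ), ∀ θ, ‖θ‖ ≤ R → ∀ k,
      ‖transport U (refinementTime Λ η k) θ - U θ‖ ≤ C * η ∧
      ‖fderiv ℝ (transport U (refinementTime Λ η k)) θ - fderiv ℝ U θ‖ ≤ C * η := by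
  obtain ⟨B, hB⟩ := exists_localBounds hU (R + 1)
  refine ⟨2 * B ^ 2, ?_⟩
  filter_upwards [self_mem_nhdsWithin, eventually_abs_refinementTime_mul_le Λ B]
    with η (hη : 0 < η) hsmall θ hθ k
  have hcΛ := abs_refinementTime_mul_le (Λ := Λ) hη k
  have htime : |refinementTime Λ η k| ≤ η / 2 := (abs_refinementTime_le hη k).trans
    (div_le_div_of_nonneg_right (min_le_left _ _) zero_le_two)
  constructor
  · refine (norm_transport_sub_le hLip hcΛ hB (hsmall k) hθ).trans ?_
    gcongr
    linarith
  · refine (norm_fderiv_transport_sub_fderiv_le hLip hcΛ hB (hsmall k) hθ).trans ?_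
    nlinarith [sq_nonneg B]

lemma exists_eventually_update_update_transport_sub_le (R : ℝ) :
    ∃ C, ∀ᶠ η in 𝓝[>] (0 : ℝ), ∀ θ, ‖θ‖ ≤ R → ∀ k,
      ‖update (transport U (refinementTime Λ η (k + 1))) (η / 2 ^ (k + 1))
          (update (transport U (refinementTime Λ η (k + 1))) (η / 2 ^ (k + 1)) θ)
        - update (transport U (refinementTime Λ η k)) (η / 2 ^ k) θ‖ ≤ C * (η / 2 ^ k) ^ 3 := by
  obtain ⟨B, hB⟩ := exists_localBounds hU (R + 1 + 1)
  refine ⟨(8 * B) ^ 3 / 8, ?_⟩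
  filter_upwards [self_mem_nhdsWithin, eventually_abs_refinementTime_mul_le Λ B,
    eventually_mul_le one_pos (2 * (8 * B)), Ioc_mem_nhdsGT (by positivity : 0 < (1 + Λ : ℝ)⁻¹)]
    with η (hη : 0 < η) hsmall hstep hcut θ hθ k
  have hcΛ := abs_refinementTime_mul_le (Λ := Λ) hη
  have hbounds := fun k => localBounds_transport hLip (hcΛ k) hB (hsmall k)
  set h := η / 2 ^ (k + 1) with hh
  have hhalf : η / 2 ^ k = 2 * h := by rw [hh, pow_succ]; field_simp
  have h0 : 0 < h := by positivity
  have hhη : h ≤ η := div_le_self hη.le (one_le_pow₀ one_le_two)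
  have hadd : ∀ x, transport U (refinementTime Λ η k)
      (x + (h / 2) • transport U (refinementTime Λ η (k + 1)) x)
      = transport U (refinementTime Λ η (k + 1)) x := fun x => by
    rw [refinementTime_succ hcut.2]
    refine transport_add hLip ((hcΛ k).trans_lt one_half_lt_one) ?_ x
    rw [← refinementTime_succ hcut.2]
    exact (hcΛ (k + 1)).trans_lt one_half_lt_one
  have hB0 := hB.pos
  have hmid := norm_add_sub_two_smul_le (hbounds k) (hbounds (k + 1)) hadd h0.le
    (le_trans (by gcongr) hstep) hθ
  rw [hhalf, update_update_sub_update, norm_neg, norm_smul, Real.norm_of_nonneg h0.le]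
  calc _ ≤ h * ((8 * B) ^ 3 * h ^ 2) := mul_le_mul_of_nonneg_left hmid h0.le
    _ = (8 * B) ^ 3 / 8 * (2 * h) ^ 3 := by ring

theorem isRefinement_transport :
    IsRefinement U fun η k => transport U (refinementTime Λ η k) where
  zero η _ := by simp [refinementTime, transport_zero]
  smooth η hη k := differentiable_transport hLip
    ((abs_refinementTime_mul_le hη k).trans_lt one_half_lt_one) (hU.differentiable two_ne_zero)
  small := by
    simpa only [@forall_comm ℕ] using
      forall_isCompact_iff_forall_norm_le.2 (exists_eventually_transport_sub_le hU hLip)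
  consistent := by
    simpa only [@forall_comm ℕ] using
      forall_isCompact_iff_forall_norm_le.2
        (exists_eventually_update_update_transport_sub_le hU hLip)

theorem exists_isRefinement_symmetricJacobian (hsym : SymmetricJacobian U) :
    ∃ V, IsRefinement U V ∧ ∀ η : ℝ, 0 < η → ∀ k, SymmetricJacobian (V η k) :=
  ⟨_, isRefinement_transport hU hLip, fun _ hη k =>
    symmetricJacobian_transport (hU.differentiable two_ne_zero) hLip hsym
      ((abs_refinementTime_mul_le hη k).trans_lt one_half_lt_one)⟩

end Refinement

/-! ### Gaussian laws -/

section GaussianIntegral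

variable {E : Type*} [NormedAddCommGroup E] [InnerProductSpace ℝ E] [FiniteDimensional ℝ E]
  [MeasurableSpace E] [BorelSpace E] {b : ℝ}

lemma integrable_exp_neg_mul_norm_sq (hb : 0 < b) :
    Integrable fun x : E => Real.exp (-b * ‖x‖ ^ 2) :=
  .of_integral_ne_zero (by rw [GaussianFourier.integral_rexp_neg_mul_sq_norm hb]; positivity)

lemma integrable_norm_sq_mul_exp_neg_mul_norm_sq (hb : 0 < b) :
    Integrable fun x : E => ‖x‖ ^ 2 * Real.exp (-b * ‖x‖ ^ 2) := by
  refine ((integrable_exp_neg_mul_norm_sq (half_pos hb)).const_mul (2 / b)).mono' (by fun_prop)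
    (.of_forall fun x => ?_)
  have hle : ‖x‖ ^ 2 ≤ 2 / b * Real.exp (b / 2 * ‖x‖ ^ 2) := by
    rw [div_mul_eq_mul_div, le_div_iff₀ hb]
    linarith [Real.add_one_le_exp (b / 2 * ‖x‖ ^ 2)]
  calc ‖‖x‖ ^ 2 * Real.exp (-b * ‖x‖ ^ 2)‖ = ‖x‖ ^ 2 * Real.exp (-b * ‖x‖ ^ 2) :=
        Real.norm_of_nonneg (by positivity)
    _ ≤ 2 / b * Real.exp (b / 2 * ‖x‖ ^ 2) * Real.exp (-b * ‖x‖ ^ 2) := by gcongr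
    _ = 2 / b * Real.exp (-(b / 2) * ‖x‖ ^ 2) := by rw [mul_assoc, ← Real.exp_add]; ring_nf

end GaussianIntegral

lemma lintegral_comp_add_smul {E : Type*} [NormedAddCommGroup E] [NormedSpace ℝ E]
    [FiniteDimensional ℝ E] [MeasurableSpace E] [BorelSpace E] (μ : Measure E) [μ.IsAddHaarMeasure]
    (f : E → ENNReal) (m : E) {s : ℝ} (hs : s ≠ 0) :
    ∫⁻ x, f (m + s • x) ∂μ
      = ENNReal.ofReal |(s ^ Module.finrank ℝ E)⁻¹| * ∫⁻ x, f x ∂μ := by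
  rw [← (measurableEmbedding_const_smul₀ hs).lintegral_map (fun y => f (m + y)),
    Measure.map_addHaar_smul μ hs, lintegral_smul_measure, lintegral_add_left_eq_self f m,
    smul_eq_mul]

lemma gaussDensity_pos (m : Param d) {v : ℝ} (hv : 0 < v) (x : Param d) :
    0 < gaussDensity m v x := by
  unfold gaussDensity; positivity

lemma continuous_gaussDensity (m : Param d) (v : ℝ) : Continuous (gaussDensity m v) := by
  unfold gaussDensity; fun_prop

lemma measurable_ofReal_gaussDensity (m : Param d) (v : ℝ) :
    Measurable fun x => ENNReal.ofReal (gaussDensity m v x) :=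
  (continuous_gaussDensity m v).measurable.ennreal_ofReal

lemma log_gaussDensity (m : Param d) {v : ℝ} (hv : 0 < v) (x : Param d) :
    Real.log (gaussDensity m v x)
      = -(d : ℝ) / 2 * Real.log (2 * Real.pi * v) - ‖x - m‖ ^ 2 / (2 * v) := by
  rw [gaussDensity, Real.log_mul (by positivity) (Real.exp_pos _).ne', Real.log_exp,
    Real.log_rpow (by positivity)]
  ring

lemma gaussDensity_le (m : Param d) {v : ℝ} (hv : 0 < v) (x : Param d) :
    gaussDensity m v x ≤ (2 * Real.pi * v) ^ (-(d : ℝ) / 2) := by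
  refine mul_le_of_le_one_right (by positivity) (Real.exp_le_one_iff.2 ?_)
  rw [neg_div]
  exact neg_nonpos.2 (by positivity)

lemma norm_add_sq_le {E : Type*} [SeminormedAddCommGroup E] (x y : E) :
    ‖x + y‖ ^ 2 ≤ 2 * (‖x‖ ^ 2 + ‖y‖ ^ 2) :=
  (pow_le_pow_left₀ (norm_nonneg _) (norm_add_le x y) 2).trans add_sq_le

lemma le_gaussDensity (m : Param d) {v : ℝ} (hv : 0 < v) (x : Param d) :
    (2 * Real.pi * v) ^ (-(d : ℝ) / 2) * Real.exp (-(v⁻¹ * ‖m‖ ^ 2)) *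
      Real.exp (-(v⁻¹ * ‖x‖ ^ 2)) ≤ gaussDensity m v x := by
  rw [gaussDensity, mul_assoc, ← Real.exp_add]
  gcongr
  calc -(v⁻¹ * ‖m‖ ^ 2) + -(v⁻¹ * ‖x‖ ^ 2) = -(2 * (‖x‖ ^ 2 + ‖-m‖ ^ 2)) / (2 * v) := by
        rw [norm_neg]; field_simp; ring
    _ ≤ -‖x - m‖ ^ 2 / (2 * v) := by
        rw [sub_eq_add_neg]
        gcongr
        exact norm_add_sq_le x (-m)

lemma gaussDensity_zero_one (x : Param d) :
    gaussDensity 0 1 x = (2 * Real.pi) ^ (-(d : ℝ) / 2) * Real.exp (-(1 / 2) * ‖x‖ ^ 2) := by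
  rw [gaussDensity, sub_zero, mul_one, mul_one]
  ring_nf

lemma integral_gaussDensity_zero_one : ∫ x : Param d, gaussDensity 0 1 x = 1 := by
  rw [funext gaussDensity_zero_one, integral_const_mul,
    GaussianFourier.integral_rexp_neg_mul_sq_norm (by norm_num), finrank_euclideanSpace_fin,
    (by ring : Real.pi / (1 / 2) = 2 * Real.pi), neg_div, Real.rpow_neg (by positivity)]
  exact inv_mul_cancel₀ (by positivity)

instance isProbabilityMeasure_gauss_zero_one : IsProbabilityMeasure (gauss (0 : Param d) 1) where
  measure_univ := by
    have hgauss : Integrable (gaussDensity (0 : Param d) 1) :=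
      .of_integral_ne_zero (by rw [integral_gaussDensity_zero_one]; exact one_ne_zero)
    rw [gauss, withDensity_apply _ MeasurableSet.univ, Measure.restrict_univ,
      ← ofReal_integral_eq_lintegral_ofReal hgauss
        (.of_forall fun x => (gaussDensity_pos 0 one_pos x).le),
      integral_gaussDensity_zero_one, ENNReal.ofReal_one]

lemma integrable_norm_sq_gauss_zero_one :
    Integrable (fun x : Param d => ‖x‖ ^ 2) (gauss 0 1) := by
  rw [gauss, integrable_withDensity_iff (measurable_ofReal_gaussDensity 0 1)
    (.of_forall fun _ => ENNReal.ofReal_lt_top)]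
  refine ((integrable_norm_sq_mul_exp_neg_mul_norm_sq one_half_pos).const_mul
    ((2 * Real.pi) ^ (-(d : ℝ) / 2))).congr (.of_forall fun x => ?_)
  dsimp only
  rw [ENNReal.toReal_ofReal (gaussDensity_pos 0 one_pos x).le, gaussDensity_zero_one]
  ring

lemma gaussDensity_add_smul (m : Param d) {s : ℝ} (hs : 0 < s) (x : Param d) :
    gaussDensity m (s ^ 2) (m + s • x) = (s ^ d)⁻¹ * gaussDensity 0 1 x := by
  have hpow : (s ^ 2) ^ (-(d : ℝ) / 2) = (s ^ d)⁻¹ := by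
    rw [← Real.rpow_natCast_mul hs.le, ← Real.rpow_natCast, ← Real.rpow_neg hs.le]
    push_cast
    ring_nf
  have hexp : -(s * ‖x‖) ^ 2 / (2 * s ^ 2) = -(1 / 2) * ‖x‖ ^ 2 := by
    field_simp
  rw [gaussDensity_zero_one, gaussDensity, add_sub_cancel_left, norm_smul,
    Real.norm_of_nonneg hs.le, Real.mul_rpow (by positivity) (by positivity), hpow, hexp]
  ring

lemma gauss_sq_eq_map (m : Param d) {s : ℝ} (hs : 0 < s) :
    gauss m (s ^ 2) = (gauss 0 1).map fun x => m + s • x := by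
  refine Measure.ext_of_lintegral _ fun f hf => ?_
  have hscale : 0 < (s ^ d)⁻¹ := by positivity
  have h := lintegral_comp_add_smul volume
    (fun y => ENNReal.ofReal (gaussDensity m (s ^ 2) y) * f y) m hs.ne'
  simp only [gaussDensity_add_smul m hs, ENNReal.ofReal_mul hscale.le, mul_assoc,
    finrank_euclideanSpace_fin, abs_of_pos hscale] at h
  rw [lintegral_const_mul' _ _ ENNReal.ofReal_ne_top,
    ENNReal.mul_right_inj (by simpa using hscale) ENNReal.ofReal_ne_top] at h
  rw [lintegral_map hf (by fun_prop), gauss, gauss,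
    lintegral_withDensity_eq_lintegral_mul _ (measurable_ofReal_gaussDensity _ _) hf,
    lintegral_withDensity_eq_lintegral_mul _ (measurable_ofReal_gaussDensity _ _) (by fun_prop)]
  exact h.symm

lemma gauss_eq_map (m : Param d) {v : ℝ} (hv : 0 < v) :
    gauss m v = (gauss 0 1).map fun x => m + √v • x := by
  rw [← gauss_sq_eq_map m (Real.sqrt_pos.2 hv), Real.sq_sqrt hv.le]

lemma isProbabilityMeasure_gauss (m : Param d) {v : ℝ} (hv : 0 < v) :
    IsProbabilityMeasure (gauss m v) := by
  rw [gauss_eq_map m hv]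
  exact Measure.isProbabilityMeasure_map (by fun_prop)

lemma integrable_norm_sq_gauss (m : Param d) {v : ℝ} (hv : 0 < v) :
    Integrable (fun x : Param d => ‖x‖ ^ 2) (gauss m v) := by
  rw [gauss_eq_map m hv, integrable_map_measure (by fun_prop) (by fun_prop)]
  have hdom := ((integrable_const (‖m‖ ^ 2)).add
    ((integrable_norm_sq_gauss_zero_one (d := d)).const_mul (‖√v‖ ^ 2))).const_mul 2
  refine hdom.mono' (by fun_prop) (.of_forall fun x => ?_)
  simpa [norm_smul, mul_pow] using norm_add_sq_le m (√v • x)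

lemma tendsto_integral_gauss {f : Param d → ℝ} (hf : Continuous f) {C : ℝ}
    (hfC : ∀ x, ‖f x‖ ≤ C * (1 + ‖x‖ ^ 2)) (μ : Param d) :
    Tendsto (fun τ => ∫ x, f x ∂(gauss μ τ)) (𝓝[>] 0) (𝓝 (f μ)) := by
  have hC : 0 ≤ C := by simpa using (norm_nonneg _).trans (hfC 0)
  have h : Tendsto (fun τ : ℝ => ∫ x, f (μ + √τ • x) ∂(gauss 0 1)) (𝓝[>] 0)
      (𝓝 (∫ _, f μ ∂(gauss (0 : Param d) 1))) := by
    refine tendsto_integral_filter_of_dominated_convergence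
      (fun x => C * (1 + 2 * (‖μ‖ ^ 2 + ‖x‖ ^ 2)))
      (.of_forall fun τ => (by fun_prop : Continuous _).aestronglyMeasurable) ?_ ?_ ?_
    · filter_upwards [Ioc_mem_nhdsGT (zero_lt_one (α := ℝ))] with τ hτ
      refine .of_forall fun x => (hfC _).trans ?_
      have hx : ‖√τ • x‖ ≤ ‖x‖ := by
        rw [norm_smul, Real.norm_of_nonneg τ.sqrt_nonneg]
        exact mul_le_of_le_one_left (norm_nonneg x) (Real.sqrt_le_one.2 hτ.2)
      gcongr
      exact (norm_add_sq_le μ _).trans (by gcongr)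
    · exact ((integrable_const _).add (((integrable_const _).add
        integrable_norm_sq_gauss_zero_one).const_mul 2)).const_mul C
    · refine .of_forall fun x => ?_
      have hc : Continuous fun τ : ℝ => f (μ + √τ • x) := by fun_prop
      simpa using (hc.tendsto 0).mono_left nhdsWithin_le_nhds
  rw [integral_const, probReal_univ, one_smul] at h
  refine h.congr' ?_
  filter_upwards [self_mem_nhdsWithin] with τ hτ
  rw [gauss_eq_map μ hτ, integral_map (by fun_prop) hf.aestronglyMeasurable]

/-! ### Bounds on the Shannon entropy -/

section Shannon

variable {ν : Measure (Param d)}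

lemma logDensity_withDensity_ofReal {q : Param d → ℝ} (hq : Measurable q) (hq₀ : ∀ x, 0 ≤ q x) :
    ∀ᵐ x ∂(volume.withDensity fun x => ENNReal.ofReal (q x)),
      logDensity (volume.withDensity fun x => ENNReal.ofReal (q x)) x = Real.log (q x) := by
  refine (withDensity_absolutelyContinuous volume _).ae_le ?_
  filter_upwards [Measure.rnDeriv_withDensity volume hq.ennreal_ofReal] with x hx
  rw [logDensity, hx, ENNReal.toReal_ofReal (hq₀ x)]

lemma integrable_logDensity [IsFiniteMeasure ν] (hm : Integrable (fun x => ‖x‖ ^ 2) ν) {a b c : ℝ}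
    (hlo : ∀ᵐ x ∂ν, a - b * ‖x‖ ^ 2 ≤ logDensity ν x) (hhi : ∀ᵐ x ∂ν, logDensity ν x ≤ c) :
    Integrable (logDensity ν) ν :=
  integrable_of_le_of_le (ν.measurable_rnDeriv volume).ennreal_toReal.log.aestronglyMeasurable
    hlo hhi ((integrable_const a).sub (hm.const_mul b)) (integrable_const c)

lemma neg_le_shannon [IsProbabilityMeasure ν] (hi : Integrable (logDensity ν) ν) {c : ℝ}
    (hhi : ∀ᵐ x ∂ν, logDensity ν x ≤ c) : -c ≤ shannon ν :=
  neg_le_neg (by simpa using integral_mono_ae hi (integrable_const c) hhi)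

-- Gibbs' inequality relative to the Gaussian `exp (-π ‖x‖²)`, whose total mass is `1`.
lemma shannon_le_pi_mul_integral_norm_sq [IsProbabilityMeasure ν] (hν : ν ≪ volume)
    (hi : Integrable (logDensity ν) ν) (hm : Integrable (fun x => ‖x‖ ^ 2) ν) :
    shannon ν ≤ Real.pi * ∫ x, ‖x‖ ^ 2 ∂ν := by
  have hexp := integrable_exp_neg_mul_norm_sq (E := Param d) Real.pi_pos
  have hlin := hm.const_mul (-Real.pi)
  have := isProbabilityMeasure_tilted hexp
  have hgibbs := InformationTheory.integral_llr_add_sub_measure_univ_nonneg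
    (hν.trans (absolutelyContinuous_tilted hexp)) (integrable_llr_tilted_right hν hlin hi hexp)
  rw [integral_llr_tilted_right hν hlin hexp hi,
    GaussianFourier.integral_rexp_neg_mul_sq_norm Real.pi_pos, div_self Real.pi_ne_zero,
    Real.one_rpow, Real.log_one, integral_const_mul, probReal_univ, probReal_univ] at hgibbs
  have : shannon ν = -∫ x, llr ν volume x ∂ν := rfl
  linarith

end Shannon

/-! ### Entropy production of the noisy update -/

section Noise

variable {Λ : NNReal} {η σ τ : ℝ}

lemma isProbabilityMeasure_jointLaw (μ : Param d) (hτ : 0 < τ) :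
    IsProbabilityMeasure (jointLaw μ τ) := by
  have := isProbabilityMeasure_gauss μ hτ
  exact inferInstanceAs (IsProbabilityMeasure ((gauss μ τ).prod (gauss 0 1)))

lemma integrable_norm_sq_jointLaw (μ : Param d) (hτ : 0 < τ) :
    Integrable (fun z => ‖z‖ ^ 2) (jointLaw μ τ) := by
  have := isProbabilityMeasure_gauss μ hτ
  have hdom : Integrable (fun z : Param d × Param d => ‖z.1‖ ^ 2 + ‖z.2‖ ^ 2) (jointLaw μ τ) :=
    ((integrable_norm_sq_gauss μ hτ).comp_fst _).add (integrable_norm_sq_gauss_zero_one.comp_snd _)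
  refine hdom.mono' (by fun_prop) (.of_forall fun z => ?_)
  rw [Real.norm_of_nonneg (by positivity), Prod.norm_def]
  rcases max_choice ‖z.1‖ ‖z.2‖ with h | h <;> rw [h] <;> simp

lemma integrable_const_mul_one_add_norm_sq_jointLaw (C : ℝ) (μ : Param d) (hτ : 0 < τ) :
    Integrable (fun z => C * (1 + ‖z‖ ^ 2)) (jointLaw μ τ) := by
  have := isProbabilityMeasure_jointLaw μ hτ
  exact ((integrable_const 1).add (integrable_norm_sq_jointLaw μ hτ)).const_mul C

lemma exists_norm_le_mul_one_add_norm {E F : Type*} [SeminormedAddCommGroup E]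
    [SeminormedAddCommGroup F] {f : E → F} (hLip : LipschitzWith Λ f) :
    ∃ A, 0 ≤ A ∧ ∀ x, ‖f x‖ ≤ A * (1 + ‖x‖) := by
  refine ⟨Λ + ‖f 0‖, by positivity, fun x => ?_⟩
  have hx : ‖f x - f 0‖ ≤ Λ * ‖x‖ := by simpa using hLip.norm_sub_le x 0
  calc ‖f x‖ ≤ ‖f x - f 0‖ + ‖f 0‖ := norm_le_norm_sub_add _ _
    _ ≤ Λ * (1 + ‖x‖) + ‖f 0‖ * (1 + ‖x‖) := by
        gcongr
        · exact hx.trans (by gcongr; simp)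
        · exact le_mul_of_one_le_right (norm_nonneg _) (by simp)
    _ = _ := by ring

lemma sq_le_of_le_mul_one_add {a c t : ℝ} (ha : 0 ≤ a) (h : a ≤ c * (1 + t)) :
    a ^ 2 ≤ 2 * c ^ 2 * (1 + t ^ 2) :=
  calc a ^ 2 ≤ (c * (1 + t)) ^ 2 := by gcongr
    _ = c ^ 2 * (1 + t) ^ 2 := by ring
    _ ≤ c ^ 2 * (2 * (1 ^ 2 + t ^ 2)) := by gcongr; exact add_sq_le
    _ = 2 * c ^ 2 * (1 + t ^ 2) := by ring

lemma continuous_noisyUpdate (hU : Continuous U) (η σ : ℝ) : Continuous (noisyUpdate U η σ) := by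
  unfold noisyUpdate update
  fun_prop

lemma norm_smul_snd_le {S : ℝ} (hσ : |σ| ≤ S) (z : Param d × Param d) :
    ‖σ • z.2‖ ≤ S * (1 + ‖z‖) := by
  rw [norm_smul, Real.norm_eq_abs]
  have : ‖z.2‖ ≤ 1 + ‖z‖ := by linarith [norm_snd_le z]
  have := (abs_nonneg σ).trans hσ
  gcongr

lemma exists_norm_noisyUpdate_le (hLip : LipschitzWith Λ U) (η S : ℝ) :
    ∃ C, 0 ≤ C ∧ ∀ σ z, |σ| ≤ S → ‖noisyUpdate U η σ z‖ ≤ C * (1 + ‖z‖) := by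
  obtain ⟨A, hA, hU⟩ := exists_norm_le_mul_one_add_norm hLip
  refine ⟨1 + |η| * A + |S|, by positivity, fun σ z hσ => ?_⟩
  have hfst := norm_fst_le z
  calc ‖noisyUpdate U η σ z‖ ≤ ‖z.1‖ + ‖η • U z.1‖ + ‖σ • z.2‖ :=
        norm_add_le_of_le (norm_sub_le _ _) le_rfl
    _ ≤ (1 + ‖z‖) + |η| * (A * (1 + ‖z‖)) + |S| * (1 + ‖z‖) := by
        rw [norm_smul η, Real.norm_eq_abs]
        gcongr
        · linarith
        · exact (hU z.1).trans (by gcongr)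
        · exact norm_smul_snd_le (hσ.trans (le_abs_self S)) z
    _ = _ := by ring

lemma exists_norm_sq_noisyUpdate_le (hLip : LipschitzWith Λ U) (η S : ℝ) :
    ∃ C, ∀ σ z, |σ| ≤ S → ‖noisyUpdate U η σ z‖ ^ 2 ≤ C * (1 + ‖z‖ ^ 2) := by
  obtain ⟨C, -, hC⟩ := exists_norm_noisyUpdate_le hLip η S
  exact ⟨2 * C ^ 2, fun σ z hσ => sq_le_of_le_mul_one_add (norm_nonneg _) (hC σ z hσ)⟩

lemma exists_norm_force_add_force_le (hLip : LipschitzWith Λ U) (η S : ℝ) :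
    ∃ C, ∀ σ z, |σ| ≤ S → ‖η • (U z.1 + U (noisyUpdate U η σ z))‖ ≤ C * (1 + ‖z‖) := by
  obtain ⟨A, hA, hU⟩ := exists_norm_le_mul_one_add_norm hLip
  obtain ⟨D, -, hnext⟩ := exists_norm_noisyUpdate_le hLip η S
  refine ⟨|η| * (A * (2 + D)), fun σ z hσ => ?_⟩
  have hfst := norm_fst_le z
  have hz := norm_nonneg z
  calc ‖η • (U z.1 + U (noisyUpdate U η σ z))‖
      ≤ |η| * (A * (1 + ‖z.1‖) + A * (1 + ‖noisyUpdate U η σ z‖)) := by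
        rw [norm_smul, Real.norm_eq_abs]
        gcongr
        exact norm_add_le_of_le (hU _) (hU _)
    _ ≤ |η| * (A * (1 + ‖z‖) + A * ((1 + ‖z‖) + D * (1 + ‖z‖))) := by
        gcongr
        · linarith
        · exact hnext σ z hσ
    _ = _ := by ring

lemma sq_mul_bathEntropy (U : Param d → Param d) (η : ℝ) (hσ : σ ≠ 0) (z : Param d × Param d) :
    σ ^ 2 * bathEntropy U η σ z
      = 1 / 2 * (‖η • (U z.1 + U (noisyUpdate U η σ z)) - σ • z.2‖ ^ 2 - ‖σ • z.2‖ ^ 2) := by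
  have hσ₂ : 0 < σ ^ 2 := by positivity
  have hforward : noisyUpdate U η σ z - update U η z.1 = σ • z.2 := add_sub_cancel_left _ _
  have hbackward : z.1 - update U η (noisyUpdate U η σ z)
      = η • (U z.1 + U (noisyUpdate U η σ z)) - σ • z.2 := by
    rw [← hforward, update, update]
    module
  rw [bathEntropy, transition, transition, Real.log_div (gaussDensity_pos _ hσ₂ _).ne'
    (gaussDensity_pos _ hσ₂ _).ne', log_gaussDensity _ hσ₂, log_gaussDensity _ hσ₂, hforward,
    hbackward]
  field_simp
  ring

lemma exists_norm_sq_mul_bathEntropy_le (hLip : LipschitzWith Λ U) (η S : ℝ) :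
    ∃ C, ∀ σ z, 0 < σ → σ ≤ S → ‖σ ^ 2 * bathEntropy U η σ z‖ ≤ C * (1 + ‖z‖ ^ 2) := by
  obtain ⟨D, hD⟩ := exists_norm_force_add_force_le hLip η S
  refine ⟨2 * D ^ 2 + 2 * S ^ 2, fun σ z hσ hσS => ?_⟩
  have habs : |σ| ≤ S := (abs_of_pos hσ).trans_le hσS
  have hforce := sq_le_of_le_mul_one_add (norm_nonneg _) (hD σ z habs)
  have hnoise := sq_le_of_le_mul_one_add (norm_nonneg _) (norm_smul_snd_le habs z)
  rw [sq_mul_bathEntropy U η hσ.ne', Real.norm_eq_abs, add_mul]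
  refine le_trans ?_ (add_le_add hforce hnoise)
  set w := η • (U z.1 + U (noisyUpdate U η σ z))
  have hdiff : ‖w - σ • z.2‖ ^ 2 ≤ 2 * (‖w‖ ^ 2 + ‖σ • z.2‖ ^ 2) := by
    simpa [sub_eq_add_neg] using norm_add_sq_le w (-(σ • z.2))
  rw [abs_le]
  constructor <;> linarith [sq_nonneg ‖w‖, sq_nonneg ‖σ • z.2‖, sq_nonneg ‖w - σ • z.2‖]

lemma continuous_transition (hU : Continuous U) (η σ : ℝ) :
    Continuous fun p : Param d × Param d => transition U η σ p.1 p.2 := by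
  unfold transition gaussDensity update
  fun_prop

lemma measurable_bathEntropy (hU : Continuous U) (η σ : ℝ) : Measurable (bathEntropy U η σ) := by
  have hp := continuous_transition hU η σ
  have hn := continuous_noisyUpdate hU η σ
  exact ((hp.comp (hn.prodMk continuous_fst)).measurable.div
    (hp.comp (continuous_fst.prodMk hn)).measurable).log

lemma integrable_bathEntropy (hLip : LipschitzWith Λ U) (η : ℝ) (hσ : 0 < σ) (μ : Param d)
    (hτ : 0 < τ) : Integrable (bathEntropy U η σ) (jointLaw μ τ) := by
  obtain ⟨C, hC⟩ := exists_norm_sq_mul_bathEntropy_le hLip η σ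
  have h : Integrable (fun z => σ ^ 2 * bathEntropy U η σ z) (jointLaw μ τ) :=
    (integrable_const_mul_one_add_norm_sq_jointLaw C μ hτ).mono'
      ((measurable_bathEntropy hLip.continuous η σ).const_mul _).aestronglyMeasurable
      (.of_forall fun z => hC σ z hσ le_rfl)
  exact (integrable_const_mul_iff (isUnit_iff_ne_zero.2 (by positivity)) _).1 h

/-- The limit of `σ² ΔS_bath` as `σ → 0`, for a noisy update started at `θ`. -/
def bathLimit (U : Param d → Param d) (η : ℝ) (θ : Param d) : ℝ :=
  1 / 2 * ‖η • (U θ + U (update U η θ))‖ ^ 2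

lemma continuous_bathLimit (hU : Continuous U) (η : ℝ) : Continuous (bathLimit U η) := by
  unfold bathLimit update
  fun_prop

lemma tendsto_sq_mul_bathEntropy (hU : Continuous U) (η : ℝ) (z : Param d × Param d) :
    Tendsto (fun σ => σ ^ 2 * bathEntropy U η σ z) (𝓝[>] 0) (𝓝 (bathLimit U η z.1)) := by
  have hc : Continuous fun σ : ℝ => 1 / 2 *
      (‖η • (U z.1 + U (noisyUpdate U η σ z)) - σ • z.2‖ ^ 2 - ‖σ • z.2‖ ^ 2) := by
    unfold noisyUpdate
    fun_prop
  refine ((hc.tendsto' 0 _ (by simp [bathLimit, noisyUpdate])).mono_left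
    nhdsWithin_le_nhds).congr' ?_
  filter_upwards [self_mem_nhdsWithin] with σ (hσ : 0 < σ)
  rw [sq_mul_bathEntropy U η hσ.ne']

lemma exists_norm_bathLimit_le (hLip : LipschitzWith Λ U) (η : ℝ) :
    ∃ C, ∀ θ, ‖bathLimit U η θ‖ ≤ C * (1 + ‖θ‖ ^ 2) := by
  obtain ⟨C, hC⟩ := exists_norm_sq_mul_bathEntropy_le hLip η 1
  refine ⟨C, fun θ =>
    le_of_tendsto (tendsto_sq_mul_bathEntropy hLip.continuous η (θ, 0)).norm ?_⟩
  filter_upwards [Ioc_mem_nhdsGT one_pos] with σ hσ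
  simpa using hC σ (θ, 0) hσ.1 hσ.2

lemma tendsto_sq_mul_integral_bathEntropy (hLip : LipschitzWith Λ U) (η : ℝ) (μ : Param d)
    (hτ : 0 < τ) :
    Tendsto (fun σ => σ ^ 2 * ∫ z, bathEntropy U η σ z ∂(jointLaw μ τ)) (𝓝[>] 0)
      (𝓝 (∫ θ, bathLimit U η θ ∂(gauss μ τ))) := by
  have := isProbabilityMeasure_gauss μ hτ
  obtain ⟨C, hC⟩ := exists_norm_sq_mul_bathEntropy_le hLip η 1
  have hfst : ∫ z, bathLimit U η z.1 ∂(jointLaw μ τ) = ∫ θ, bathLimit U η θ ∂(gauss μ τ) := by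
    rw [jointLaw, integral_fun_fst, probReal_univ, one_smul]
  simp only [← integral_const_mul, ← hfst]
  refine tendsto_integral_filter_of_dominated_convergence (fun z => C * (1 + ‖z‖ ^ 2))
    (.of_forall fun σ =>
      ((measurable_bathEntropy hLip.continuous η σ).const_mul _).aestronglyMeasurable)
    ?_ (integrable_const_mul_one_add_norm_sq_jointLaw C μ hτ)
    (.of_forall (tendsto_sq_mul_bathEntropy hLip.continuous η))
  filter_upwards [Ioc_mem_nhdsGT one_pos] with σ hσ
  exact .of_forall fun z => hC σ z hσ.1 hσ.2

/-- The density of the law of `θ_{k+1}`: the transition density averaged over the law of `θ_k`. -/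
def nextDensity (U : Param d → Param d) (η σ : ℝ) (μ : Param d) (τ : ℝ) (x : Param d) : ℝ :=
  ∫ θ, transition U η σ x θ ∂(gauss μ τ)

lemma transition_nonneg (U : Param d → Param d) (η : ℝ) (hσ : σ ≠ 0) (x θ : Param d) :
    0 ≤ transition U η σ x θ :=
  (gaussDensity_pos _ (by positivity) _).le

lemma transition_le (U : Param d → Param d) (η : ℝ) (hσ : σ ≠ 0) (x θ : Param d) :
    transition U η σ x θ ≤ (2 * Real.pi * σ ^ 2) ^ (-(d : ℝ) / 2) :=
  gaussDensity_le _ (by positivity) _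

lemma integrable_transition (hU : Continuous U) (η : ℝ) (hσ : σ ≠ 0) (μ : Param d) (hτ : 0 < τ)
    (x : Param d) : Integrable (transition U η σ x) (gauss μ τ) := by
  have := isProbabilityMeasure_gauss μ hτ
  refine .of_bound ((continuous_transition hU η σ).comp (.prodMk_right x)).aestronglyMeasurable
    ((2 * Real.pi * σ ^ 2) ^ (-(d : ℝ) / 2)) (.of_forall fun θ => ?_)
  rw [Real.norm_of_nonneg (transition_nonneg U η hσ x θ)]
  exact transition_le U η hσ x θ

lemma ofReal_nextDensity (hU : Continuous U) (η : ℝ) (hσ : σ ≠ 0) (μ : Param d) (hτ : 0 < τ)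
    (x : Param d) : ENNReal.ofReal (nextDensity U η σ μ τ x)
      = ∫⁻ θ, ENNReal.ofReal (transition U η σ x θ) ∂(gauss μ τ) :=
  ofReal_integral_eq_lintegral_ofReal (integrable_transition hU η hσ μ hτ x)
    (.of_forall (transition_nonneg U η hσ x))

lemma nextDensity_nonneg (U : Param d → Param d) (η : ℝ) (hσ : σ ≠ 0) (μ : Param d) (τ : ℝ)
    (x : Param d) : 0 ≤ nextDensity U η σ μ τ x :=
  integral_nonneg (transition_nonneg U η hσ x)

lemma measurable_nextDensity (hU : Continuous U) (η σ : ℝ) (μ : Param d) (hτ : 0 < τ) :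
    Measurable (nextDensity U η σ μ τ) := by
  have := isProbabilityMeasure_gauss μ hτ
  exact (continuous_transition hU η σ).stronglyMeasurable.integral_prod_right.measurable

lemma lintegral_noisyUpdate (U : Param d → Param d) (η : ℝ) (hσ : 0 < σ) (θ : Param d)
    {f : Param d → ENNReal} (hf : Measurable f) :
    ∫⁻ ε, f (noisyUpdate U η σ (θ, ε)) ∂(gauss 0 1)
      = ∫⁻ x, ENNReal.ofReal (transition U η σ x θ) * f x := by
  have hmap : gauss (update U η θ) (σ ^ 2) = (gauss 0 1).map fun ε => noisyUpdate U η σ (θ, ε) :=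
    gauss_sq_eq_map _ hσ
  rw [← lintegral_map hf (by dsimp only [noisyUpdate]; fun_prop), ← hmap, gauss,
    lintegral_withDensity_eq_lintegral_mul _ (measurable_ofReal_gaussDensity _ _) hf]
  rfl

lemma nextLaw_eq_withDensity (hU : Continuous U) (η : ℝ) (hσ : 0 < σ) (μ : Param d) (hτ : 0 < τ) :
    nextLaw U η σ μ τ = volume.withDensity fun x => ENNReal.ofReal (nextDensity U η σ μ τ x) := by
  have := isProbabilityMeasure_gauss μ hτ
  have hn := (continuous_noisyUpdate hU η σ).measurable
  have hp : Measurable (Function.uncurry fun x θ => ENNReal.ofReal (transition U η σ x θ)) :=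
    (continuous_transition hU η σ).measurable.ennreal_ofReal
  refine Measure.ext_of_lintegral _ fun f hf => ?_
  calc ∫⁻ x, f x ∂(nextLaw U η σ μ τ)
      = ∫⁻ θ, ∫⁻ ε, f (noisyUpdate U η σ (θ, ε)) ∂(gauss 0 1) ∂(gauss μ τ) := by
        rw [nextLaw, lintegral_map hf hn, jointLaw,
          lintegral_prod (f <| noisyUpdate U η σ ·) (hf.comp hn).aemeasurable]
    _ = ∫⁻ θ, ∫⁻ x, ENNReal.ofReal (transition U η σ x θ) * f x ∂volume ∂(gauss μ τ) := by
        simp only [lintegral_noisyUpdate U η hσ _ hf]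
    _ = ∫⁻ x, ∫⁻ θ, ENNReal.ofReal (transition U η σ x θ) * f x ∂(gauss μ τ) := by
        rw [lintegral_lintegral_swap]
        exact ((hp.comp measurable_swap).mul (hf.comp measurable_snd)).aemeasurable
    _ = ∫⁻ x, ENNReal.ofReal (nextDensity U η σ μ τ x) * f x := by
        refine lintegral_congr fun x => ?_
        rw [ofReal_nextDensity hU η hσ.ne' μ hτ]
        rw [lintegral_mul_const _ (hp.of_uncurry_left)]
    _ = _ := by
        rw [lintegral_withDensity_eq_lintegral_mul _
          (measurable_nextDensity hU η σ μ hτ).ennreal_ofReal hf]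
        rfl

lemma isProbabilityMeasure_nextLaw (hU : Continuous U) (η σ : ℝ) (μ : Param d) (hτ : 0 < τ) :
    IsProbabilityMeasure (nextLaw U η σ μ τ) := by
  have := isProbabilityMeasure_jointLaw μ hτ
  exact Measure.isProbabilityMeasure_map (continuous_noisyUpdate hU η σ).aemeasurable

lemma nextDensity_le (hU : Continuous U) (η : ℝ) (hσ : σ ≠ 0) (μ : Param d) (hτ : 0 < τ)
    (x : Param d) : nextDensity U η σ μ τ x ≤ (2 * Real.pi * σ ^ 2) ^ (-(d : ℝ) / 2) := by
  have := isProbabilityMeasure_gauss μ hτ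
  simpa [nextDensity] using integral_mono (integrable_transition hU η hσ μ hτ x)
    (integrable_const _) (transition_le U η hσ x)

lemma exists_le_nextDensity (hU : Continuous U) (η : ℝ) (hσ : σ ≠ 0) (μ : Param d) (hτ : 0 < τ) :
    ∃ a, 0 < a ∧ ∀ x, a * Real.exp (-((σ ^ 2)⁻¹ * ‖x‖ ^ 2)) ≤ nextDensity U η σ μ τ x := by
  have := isProbabilityMeasure_gauss μ hτ
  have hσ₂ : 0 < σ ^ 2 := by positivity
  have hi : Integrable (fun θ => Real.exp (-((σ ^ 2)⁻¹ * ‖update U η θ‖ ^ 2))) (gauss μ τ) := by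
    refine .of_bound (by unfold update; fun_prop) 1 (.of_forall fun θ => ?_)
    rw [Real.norm_of_nonneg (Real.exp_pos _).le, Real.exp_le_one_iff]
    exact neg_nonpos.2 (by positivity)
  have hpos := integral_exp_pos hi
  refine ⟨(2 * Real.pi * σ ^ 2) ^ (-(d : ℝ) / 2)
    * ∫ θ, Real.exp (-((σ ^ 2)⁻¹ * ‖update U η θ‖ ^ 2)) ∂(gauss μ τ), by positivity, fun x => ?_⟩
  rw [← integral_const_mul, ← integral_mul_const]
  exact integral_mono ((hi.const_mul _).mul_const _) (integrable_transition hU η hσ μ hτ x)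
    fun θ => le_gaussDensity (update U η θ) hσ₂ x

lemma integrable_norm_sq_noisyUpdate (hLip : LipschitzWith Λ U) (η σ : ℝ) (μ : Param d)
    (hτ : 0 < τ) : Integrable (fun z => ‖noisyUpdate U η σ z‖ ^ 2) (jointLaw μ τ) := by
  obtain ⟨C, hC⟩ := exists_norm_sq_noisyUpdate_le hLip η |σ|
  refine (integrable_const_mul_one_add_norm_sq_jointLaw C μ hτ).mono'
    ((continuous_noisyUpdate hLip.continuous η σ).norm.pow 2).aestronglyMeasurable
    (.of_forall fun z => ?_)
  rw [Real.norm_of_nonneg (by positivity)]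
  exact hC σ z le_rfl

lemma integrable_norm_sq_nextLaw (hLip : LipschitzWith Λ U) (η σ : ℝ) (μ : Param d)
    (hτ : 0 < τ) : Integrable (fun x => ‖x‖ ^ 2) (nextLaw U η σ μ τ) := by
  rw [nextLaw, integrable_map_measure (by fun_prop)
    (continuous_noisyUpdate hLip.continuous η σ).aemeasurable]
  exact integrable_norm_sq_noisyUpdate hLip η σ μ hτ

lemma exists_integral_norm_sq_nextLaw_le (hLip : LipschitzWith Λ U) (η S : ℝ) (μ : Param d)
    (hτ : 0 < τ) : ∃ M, ∀ σ, |σ| ≤ S → ∫ x, ‖x‖ ^ 2 ∂(nextLaw U η σ μ τ) ≤ M := by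
  obtain ⟨C, hC⟩ := exists_norm_sq_noisyUpdate_le hLip η S
  refine ⟨∫ z, C * (1 + ‖z‖ ^ 2) ∂(jointLaw μ τ), fun σ hσ => ?_⟩
  rw [nextLaw, integral_map (continuous_noisyUpdate hLip.continuous η σ).aemeasurable
    (by fun_prop)]
  exact integral_mono (integrable_norm_sq_noisyUpdate hLip η σ μ hτ)
    (integrable_const_mul_one_add_norm_sq_jointLaw C μ hτ) fun z => hC σ z hσ

lemma exists_logDensity_nextLaw_bounds (hU : Continuous U) (η : ℝ) (hσ : 0 < σ) (μ : Param d)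
    (hτ : 0 < τ) : ∃ a, ∀ᵐ x ∂(nextLaw U η σ μ τ),
      a - (σ ^ 2)⁻¹ * ‖x‖ ^ 2 ≤ logDensity (nextLaw U η σ μ τ) x ∧
      logDensity (nextLaw U η σ μ τ) x ≤ -(d / 2 * Real.log (2 * Real.pi * σ ^ 2)) := by
  obtain ⟨a, ha, hlo⟩ := exists_le_nextDensity hU η hσ.ne' μ hτ
  refine ⟨Real.log a, ?_⟩
  rw [nextLaw_eq_withDensity hU η hσ μ hτ]
  filter_upwards [logDensity_withDensity_ofReal (measurable_nextDensity hU η σ μ hτ)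
    (nextDensity_nonneg U η hσ.ne' μ τ)] with x hx
  have hpos : 0 < a * Real.exp (-((σ ^ 2)⁻¹ * ‖x‖ ^ 2)) := by positivity
  rw [hx]
  constructor
  · calc _ = Real.log (a * Real.exp (-((σ ^ 2)⁻¹ * ‖x‖ ^ 2))) := by
          rw [Real.log_mul ha.ne' (Real.exp_pos _).ne', Real.log_exp, sub_eq_add_neg]
      _ ≤ _ := Real.log_le_log hpos (hlo x)
  · calc _ ≤ Real.log ((2 * Real.pi * σ ^ 2) ^ (-(d : ℝ) / 2)) :=
          Real.log_le_log (hpos.trans_le (hlo x)) (nextDensity_le hU η hσ.ne' μ hτ x)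
      _ = _ := by rw [Real.log_rpow (by positivity)]; ring

lemma integrable_logDensity_nextLaw (hLip : LipschitzWith Λ U) (η : ℝ) (hσ : 0 < σ) (μ : Param d)
    (hτ : 0 < τ) : Integrable (logDensity (nextLaw U η σ μ τ)) (nextLaw U η σ μ τ) := by
  have := isProbabilityMeasure_nextLaw hLip.continuous η σ μ hτ
  obtain ⟨a, ha⟩ := exists_logDensity_nextLaw_bounds hLip.continuous η hσ μ hτ
  exact integrable_logDensity (integrable_norm_sq_nextLaw hLip η σ μ hτ) (ha.mono fun _ => And.left)
    (ha.mono fun _ => And.right)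

lemma integrable_logDensity_gauss (μ : Param d) (hτ : 0 < τ) :
    Integrable (logDensity (gauss μ τ)) (gauss μ τ) := by
  have := isProbabilityMeasure_gauss μ hτ
  have hlog : ∀ᵐ x ∂(gauss μ τ), logDensity (gauss μ τ) x = Real.log (gaussDensity μ τ x) :=
    logDensity_withDensity_ofReal (continuous_gaussDensity μ τ).measurable fun x =>
      (gaussDensity_pos μ hτ x).le
  refine integrable_logDensity (integrable_norm_sq_gauss μ hτ)
    (a := -(d : ℝ) / 2 * Real.log (2 * Real.pi * τ) - τ⁻¹ * ‖μ‖ ^ 2) (b := τ⁻¹)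
    (c := -(d : ℝ) / 2 * Real.log (2 * Real.pi * τ)) (hlog.mono fun x hx => ?_)
    (hlog.mono fun x hx => ?_)
  · rw [hx, sub_sub, ← mul_add]
    have hq := Real.log_le_log (by positivity) (le_gaussDensity μ hτ x)
    rw [Real.log_mul (by positivity) (by positivity), Real.log_mul (by positivity) (by positivity),
      Real.log_rpow (by positivity), Real.log_exp, Real.log_exp] at hq
    linarith
  · refine hx.trans_le ?_
    rw [log_gaussDensity μ hτ]
    exact sub_le_self _ (by positivity)

lemma entropyWellDefined (hLip : LipschitzWith Λ U) (η : ℝ) (hσ : 0 < σ) (μ : Param d)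
    (hτ : 0 < τ) : EntropyWellDefined U η σ μ τ where
  init_prob := isProbabilityMeasure_gauss μ hτ
  next_prob := isProbabilityMeasure_nextLaw hLip.continuous η σ μ hτ
  next_ac := by
    rw [nextLaw_eq_withDensity hLip.continuous η hσ μ hτ]
    exact withDensity_absolutelyContinuous _ _
  bath := integrable_bathEntropy hLip η hσ μ hτ
  sys_init := integrable_logDensity_gauss μ hτ
  sys_next := integrable_logDensity_nextLaw hLip η hσ μ hτ

lemma le_shannon_nextLaw (hLip : LipschitzWith Λ U) (η : ℝ) (hσ : 0 < σ) (μ : Param d)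
    (hτ : 0 < τ) : d / 2 * Real.log (2 * Real.pi * σ ^ 2) ≤ shannon (nextLaw U η σ μ τ) := by
  have := isProbabilityMeasure_nextLaw hLip.continuous η σ μ hτ
  obtain ⟨a, ha⟩ := exists_logDensity_nextLaw_bounds hLip.continuous η hσ μ hτ
  simpa using neg_le_shannon (integrable_logDensity_nextLaw hLip η hσ μ hτ)
    (ha.mono fun _ => And.right)

lemma exists_shannon_nextLaw_le (hLip : LipschitzWith Λ U) (η S : ℝ) (μ : Param d) (hτ : 0 < τ) :
    ∃ M, ∀ σ, 0 < σ → σ ≤ S → shannon (nextLaw U η σ μ τ) ≤ M := by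
  obtain ⟨M, hM⟩ := exists_integral_norm_sq_nextLaw_le hLip η S μ hτ
  refine ⟨Real.pi * M, fun σ hσ hσS => ?_⟩
  have hwd := entropyWellDefined hLip η hσ μ hτ
  have := hwd.next_prob
  refine (shannon_le_pi_mul_integral_norm_sq hwd.next_ac hwd.sys_next
    (integrable_norm_sq_nextLaw hLip η σ μ hτ)).trans ?_
  have := Real.pi_pos
  gcongr
  exact hM σ ((abs_of_pos hσ).trans_le hσS)

lemma tendsto_sq_mul_const_nhdsGT_zero (c : ℝ) :
    Tendsto (fun σ : ℝ => σ ^ 2 * c) (𝓝[>] 0) (𝓝 0) :=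
  ((by fun_prop : Continuous fun σ : ℝ => σ ^ 2 * c).tendsto' 0 0 (by simp)).mono_left
    nhdsWithin_le_nhds

lemma tendsto_sq_mul_log_nhdsGT_zero {a : ℝ} (ha : a ≠ 0) (c : ℝ) :
    Tendsto (fun σ : ℝ => σ ^ 2 * (c * Real.log (a * σ ^ 2))) (𝓝[>] 0) (𝓝 0) := by
  have hc : Continuous fun σ : ℝ => c / a * ((a * σ ^ 2) * Real.log (a * σ ^ 2)) :=
    (Real.continuous_mul_log.comp (by fun_prop : Continuous fun σ : ℝ => a * σ ^ 2)).const_mul _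
  refine ((hc.tendsto' 0 0 (by simp)).mono_left nhdsWithin_le_nhds).congr fun σ => ?_
  field_simp

lemma tendsto_sq_mul_shannon_nextLaw (hLip : LipschitzWith Λ U) (η : ℝ) (μ : Param d)
    (hτ : 0 < τ) : Tendsto (fun σ => σ ^ 2 * shannon (nextLaw U η σ μ τ)) (𝓝[>] 0) (𝓝 0) := by
  obtain ⟨M, hM⟩ := exists_shannon_nextLaw_le hLip η 1 μ hτ
  refine tendsto_of_tendsto_of_tendsto_of_le_of_le'
    (tendsto_sq_mul_log_nhdsGT_zero Real.two_pi_pos.ne' (d / 2))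
    (tendsto_sq_mul_const_nhdsGT_zero M) ?_ ?_
  · filter_upwards [self_mem_nhdsWithin] with σ hσ
    gcongr
    exact le_shannon_nextLaw hLip η hσ μ hτ
  · filter_upwards [Ioc_mem_nhdsGT one_pos] with σ hσ
    gcongr
    exact hM σ hσ.1 hσ.2

lemma hasScaledEntropyProduction_bathLimit (hLip : LipschitzWith Λ U) (η : ℝ) (μ : Param d) :
    HasScaledEntropyProduction U η μ (bathLimit U η μ) := by
  obtain ⟨C, hC⟩ := exists_norm_bathLimit_le hLip η
  refine ⟨fun τ σ hτ hσ => entropyWellDefined hLip η hσ μ hτ,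
    fun τ => ∫ θ, bathLimit U η θ ∂(gauss μ τ), fun τ hτ => ?_,
    tendsto_integral_gauss (continuous_bathLimit hLip.continuous η) hC μ⟩
  have h := (tendsto_sq_mul_integral_bathEntropy hLip η μ hτ).add
    ((tendsto_sq_mul_shannon_nextLaw hLip η μ hτ).sub
      (tendsto_sq_mul_const_nhdsGT_zero (shannon (gauss μ τ))))
  simpa only [meanTotalEntropy, mul_add, mul_sub, sub_zero, add_zero] using h

lemma HasScaledEntropyProduction.unique {μ : Param d} {L L' : ℝ}
    (h : HasScaledEntropyProduction U η μ L) (h' : HasScaledEntropyProduction U η μ L') :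
    L = L' := by
  obtain ⟨-, l, hl, hL⟩ := h
  obtain ⟨-, l', hl', hL'⟩ := h'
  refine tendsto_nhds_unique hL (hL'.congr' ?_)
  filter_upwards [self_mem_nhdsWithin] with τ hτ
  exact tendsto_nhds_unique (hl' τ hτ) (hl τ hτ)

lemma norm_force_update_sub_force_le (hLip : LipschitzWith Λ U) (η : ℝ) (θ : Param d) :
    ‖U (update U η θ) - U θ‖ ≤ Λ * (|η| * ‖U θ‖) := by
  simpa [update, norm_smul] using hLip.norm_sub_le (update U η θ) θ

lemma bathLimit_sub_leading (U : Param d → Param d) (η : ℝ) (θ : Param d) :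
    bathLimit U η θ - 8 * η * leading U η θ = η ^ 2 * (2 * inner ℝ (U θ) (U (update U η θ) - U θ)
      + 1 / 2 * ‖U (update U η θ) - U θ‖ ^ 2) := by
  have hsum : U θ + U (update U η θ) = (2 : ℝ) • U θ + (U (update U η θ) - U θ) := by module
  rw [bathLimit, leading, hsum, norm_smul, mul_pow, norm_add_sq_real, norm_smul,
    real_inner_smul_left, Real.norm_ofNat, Real.norm_eq_abs, sq_abs]
  ring

lemma locO_bathLimit_sub_leading (hLip : LipschitzWith Λ U) :
    LocO 3 fun η θ => bathLimit U η θ - 8 * η * leading U η θ := by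
  refine locO_iff.2 fun R => ?_
  obtain ⟨B, hB⟩ := exists_norm_le_of_continuous hLip.continuous R
  refine ⟨Λ * B * (2 * B + 1 / 2 * (Λ * B)), ?_⟩
  filter_upwards [Ioc_mem_nhdsGT one_pos] with η hη θ hθ
  have hη₀ := hη.1.le
  have hUθ := hB θ hθ
  have hB₀ : 0 ≤ B := (norm_nonneg _).trans hUθ
  set w := U (update U η θ) - U θ with hw_def
  have hw : ‖w‖ ≤ η * (Λ * B) :=
    calc ‖w‖ ≤ Λ * (|η| * ‖U θ‖) := norm_force_update_sub_force_le hLip η θ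
      _ ≤ Λ * (η * B) := by rw [abs_of_nonneg hη₀]; gcongr
      _ = η * (Λ * B) := by ring
  have hw' : ‖w‖ ≤ Λ * B := hw.trans (mul_le_of_le_one_left (by positivity) hη.2)
  rw [bathLimit_sub_leading, ← hw_def]
  calc ‖η ^ 2 * (2 * inner ℝ (U θ) w + 1 / 2 * ‖w‖ ^ 2)‖
      ≤ η ^ 2 * (2 * (‖U θ‖ * ‖w‖) + 1 / 2 * ‖w‖ ^ 2) := by
        rw [norm_mul, Real.norm_of_nonneg (sq_nonneg η)]
        gcongr
        refine norm_add_le_of_le ?_ (Real.norm_of_nonneg (by positivity)).le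
        rw [norm_mul, Real.norm_ofNat]
        gcongr
        exact norm_inner_le_norm _ _
    _ = η ^ 2 * (‖w‖ * (2 * ‖U θ‖ + 1 / 2 * ‖w‖)) := by ring
    _ ≤ η ^ 2 * (η * (Λ * B) * (2 * B + 1 / 2 * (Λ * B))) := by gcongr
    _ = _ := by ring

theorem isSTPotential_leading (hLip : LipschitzWith Λ U) : IsSTPotential U (leading U) :=
  ⟨bathLimit U, fun η _ μ => hasScaledEntropyProduction_bathLimit hLip η μ,
    locO_bathLimit_sub_leading hLip⟩

theorem IsSTPotential.eqLeading (hLip : LipschitzWith Λ U) {φ : ℝ → Param d → ℝ}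
    (h : IsSTPotential U φ) : EqLeading U φ := by
  obtain ⟨L, hL, hφ⟩ := h
  refine LocO.of_smul (((locO_bathLimit_sub_leading hLip).add (hφ.const_smul (-1))).const_smul
    (1 / 8) |>.congr fun η hη μ => ?_)
  rw [(hL η hη μ).unique (hasScaledEntropyProduction_bathLimit hLip η μ)]
  simp only [smul_eq_mul]
  ring

end Noise

end Irrev

end

theorem mainTheorem1 {d : ℕ} (U : Irrev.Param d → Irrev.Param d) (hU : ContDiff ℝ 2 U)
    (Λ : NNReal) (hLip : LipschitzWith Λ U) (hsym : Irrev.SymmetricJacobian U) :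
    -- discretization error
    (Irrev.IsDEPotential U (Irrev.leading U) ∧
      ∀ φ : ℝ → Irrev.Param d → ℝ, Irrev.IsDEPotential U φ → Irrev.EqLeadingUpToConst U φ) ∧
    -- time reversal asymmetry
    (Irrev.IsTAPotential U (Irrev.leading U) ∧
      (∀ φ : ℝ → Irrev.Param d → ℝ, Irrev.IsTAPotential U φ → Irrev.EqLeadingUpToConst U φ) ∧
      ∀ θref : Irrev.Param d,
        Irrev.EqLeading U fun η θ =>
          Irrev.taLinePotential U θref η θ + Irrev.leading U η θref) ∧
    -- time renormalization
    ((∃ V : ℝ → ℕ → Irrev.Param d → Irrev.Param d, Irrev.IsRefinement U V ∧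
        ∀ η : ℝ, 0 < η → ∀ k, Irrev.SymmetricJacobian (V η k)) ∧
      ∀ V : ℝ → ℕ → Irrev.Param d → Irrev.Param d, Irrev.IsRefinement U V →
        Irrev.IsTRPotential U V (Irrev.leading U) ∧
        ∀ φ : ℝ → Irrev.Param d → ℝ, Irrev.IsTRPotential U V φ →
          Irrev.EqLeadingUpToConst U φ) ∧
    -- stochastic entropy
    (Irrev.IsSTPotential U (Irrev.leading U) ∧
      ∀ φ : ℝ → Irrev.Param d → ℝ, Irrev.IsSTPotential U φ → Irrev.EqLeading U φ) := by
  exact ⟨⟨Irrev.isDEPotential_leading hU hLip hsym, fun _ h => h.eqLeadingUpToConst hU hsym⟩,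
    ⟨Irrev.isTAPotential_leading hU hsym, fun _ h => h.eqLeadingUpToConst hU hsym,
      Irrev.taLinePotential_eqLeading hU hsym⟩,
    ⟨Irrev.exists_isRefinement_symmetricJacobian hU hLip hsym, fun _ hV =>
      ⟨hV.isTRPotential_leading hU hsym, fun _ h => h.eqLeadingUpToConst hU hsym hV⟩⟩,
    Irrev.isSTPotential_leading hLip, fun _ h => h.eqLeading hLip⟩
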